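/- **Semi-Metric TSP.** An instance $I$ consists of $n$ vertices $V=\{0,\dots,n-1\}$ and a (not necessarily symmetric) weight function $w:V^2\to\mathbb{R}$ with $w(x,z)\le w(x,y)+w(y,z)$ for all $x,y,z\in V$. A solution is a directed Hamiltonian cycle, i.e. an ordering $v_0,\dots,v_{n-1}$ of $V$, of weight $\sum_{i} w(v_i,v_{i+1 \bmod n})$; let $\mathrm{OPT}_I$ be the minimum weight of a solution. **Reductions.** Let $r\ge 1$ and $f:\mathbb{R}\to\mathbb{R}$. An $(r,f)$-*reduction* of this problem is a pair of algorithms, the *reducer* and the *merger*, with a constant $C$ such that for every instance $I$ with $n$ vertices: * the reducer transforms $I$ into finitely many instances $I_1,\dots,I_q$ of the problem, each with at most $n/r+C$ vertices; * from any solutions $S_1,\dots,S_q$ of $I_1,\dots,I_q$ (and from $I$ and the information computed by the reducer) the merger computes a solution $S$ of $I$; and whenever $\alpha\ge1$ is such that $w(S_j)\le\alpha\,\mathrm{OPT}_{I_j}$ for all $j$, then $w(S)\le f(\alpha)\,\mathrm{OPT}_I$. (The merger is not given $\alpha$.) Its time complexity is the sum of the worst-case time complexities of reducer and merger, as a function of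 $n$, on a unit-cost random access machine with an integer and a real memory; integers may be added, subtracted (subtraction truncated at $0$), compared and used as addresses, and reals may be added, subtracted and compared. It is *polynomial-time* if the time, and hence also $q$, is bounded by a polynomial in $n$ (the algorithms, the constant $C$ and the polynomial may depend on $r$). A polynomial-time reduction scheme with approximation $a(r,\alpha)$ for all $r$ in an unbounded set $R$ consists of a polynomial-time $(r,a(r,\cdot))$-reduction for each $r\in R$. **Statement.** There is a polynomial-time reduction scheme for Semi-Metric TSP with approximation $a(r,\alpha)=\alpha+\log_2 r$, for any $r=2^k$, $k\in\mathbb{N}$. -/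

import Mathlib

/-! ### Semi-Metric TSP -/

/-- An instance of Semi-Metric TSP: `n` vertices and a (not necessarily symmetric) weight function
`w : V² → ℝ` that satisfies the triangle inequality. -/
structure SemiMetricTSP where
  n : ℕ
  w : Fin n → Fin n → ℝ
  triangle : ∀ x y z, w x z ≤ w x y + w y z

namespace SemiMetricTSP

/-- A directed Hamiltonian cycle, given by the order `π 0, π 1, …, π (n-1)` in which it visits the
vertices. -/
abbrev Tour (I : SemiMetricTSP) : Type := Equiv.Perm (Fin I.n)

/-- The weight of a directed Hamiltonian cycle; `finRotate` is the map `i ↦ i + 1` modulo `n`. -/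
def weight (I : SemiMetricTSP) (π : I.Tour) : ℝ :=
  ∑ i : Fin I.n, I.w (π i) (π (finRotate I.n i))

/-- The weight of a lightest directed Hamiltonian cycle. -/
noncomputable def opt (I : SemiMetricTSP) : ℝ :=
  (Finset.univ : Finset I.Tour).inf' Finset.univ_nonempty I.weight

end SemiMetricTSP

/-! ### A machine model: unit-cost random access programs with integer and real arrays

Real numbers can only be added, subtracted, compared and copied; natural numbers can be added,
subtracted, compared and used as addresses. There is no multiplication. -/

/-- The memory. Each variable (named by a natural number) is an unbounded three-dimensional array
of natural numbers, respectively of real numbers; a scalar variable is the cell `[0, 0, 0]`. -/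
structure Store where
  nat : ℕ → ℕ → ℕ → ℕ → ℕ
  real : ℕ → ℕ → ℕ → ℕ → ℝ

/-- Write `a` to the cell `[i, j, l]` of the natural number array `v`. -/
def Store.setNat (s : Store) (v i j l a : ℕ) : Store :=
  { s with nat := fun v' i' j' l' =>
      if v' = v ∧ i' = i ∧ j' = j ∧ l' = l then a else s.nat v' i' j' l' }

/-- Write `a` to the cell `[i, j, l]` of the real array `v`. -/
def Store.setReal (s : Store) (v i j l : ℕ) (a : ℝ) : Store :=
  { s with real := fun v' i' j' l' =>
      if v' = v ∧ i' = i ∧ j' = j ∧ l' = l then a else s.real v' i' j' l' }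

/-- Natural number expressions (`sub` is truncated subtraction). -/
inductive NExp : Type
  | const (c : ℕ)
  | get (v : ℕ) (i j l : NExp)
  | add (a b : NExp)
  | sub (a b : NExp)

/-- The value of an expression. -/
def NExp.eval (s : Store) : NExp → ℕ
  | const c => c
  | get v i j l => s.nat v (i.eval s) (j.eval s) (l.eval s)
  | add a b => a.eval s + b.eval s
  | sub a b => a.eval s - b.eval s

/-- The number of elementary operations in the evaluation of an expression. -/
def NExp.cost : NExp → ℕ
  | const _ => 1
  | get _ i j l => i.cost + j.cost + l.cost + 1
  | add a b => a.cost + b.cost + 1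
  | sub a b => a.cost + b.cost + 1

/-- Real expressions. -/
inductive RExp : Type
  | zero
  | get (v : ℕ) (i j l : NExp)
  | add (a b : RExp)
  | sub (a b : RExp)

/-- The value of an expression. -/
noncomputable def RExp.eval (s : Store) : RExp → ℝ
  | zero => 0
  | get v i j l => s.real v (i.eval s) (j.eval s) (l.eval s)
  | add a b => a.eval s + b.eval s
  | sub a b => a.eval s - b.eval s

/-- The number of elementary operations in the evaluation of an expression. -/
def RExp.cost : RExp → ℕ
  | zero => 1
  | get _ i j l => i.cost + j.cost + l.cost + 1
  | add a b => a.cost + b.cost + 1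
  | sub a b => a.cost + b.cost + 1

/-- Boolean tests. -/
inductive BExp : Type
  | natLe (a b : NExp)
  | realLe (a b : RExp)
  | not (b : BExp)
  | and (b c : BExp)

/-- The truth value of a test. -/
def BExp.Holds (s : Store) : BExp → Prop
  | natLe a b => a.eval s ≤ b.eval s
  | realLe a b => a.eval s ≤ b.eval s
  | not b => ¬ b.Holds s
  | and b c => b.Holds s ∧ c.Holds s

/-- The number of elementary operations in the evaluation of a test. -/
def BExp.cost : BExp → ℕ
  | natLe a b => a.cost + b.cost + 1
  | realLe a b => a.cost + b.cost + 1
  | not b => b.cost + 1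
  | and b c => b.cost + c.cost + 1

/-- Programs. -/
inductive Prog : Type
  | skip
  | setNat (v : ℕ) (i j l : NExp) (e : NExp)
  | setReal (v : ℕ) (i j l : NExp) (e : RExp)
  | seq (p q : Prog)
  | branch (b : BExp) (p q : Prog)
  | loop (b : BExp) (p : Prog)

/-- `Exec p s t s'`: program `p`, started with memory `s`, halts after exactly `t` elementary
operations with memory `s'`. (`loop b p` is "while `b` do `p`".) -/
inductive Exec : Prog → Store → ℕ → Store → Prop
  | skip (s : Store) : Exec .skip s 1 s
  | setNat (s : Store) (v : ℕ) (i j l : NExp) (e : NExp) :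
      Exec (.setNat v i j l e) s (i.cost + j.cost + l.cost + e.cost + 1)
        (s.setNat v (i.eval s) (j.eval s) (l.eval s) (e.eval s))
  | setReal (s : Store) (v : ℕ) (i j l : NExp) (e : RExp) :
      Exec (.setReal v i j l e) s (i.cost + j.cost + l.cost + e.cost + 1)
        (s.setReal v (i.eval s) (j.eval s) (l.eval s) (e.eval s))
  | seq {p q : Prog} {s₁ s₂ s₃ : Store} {t₁ t₂ : ℕ} :
      Exec p s₁ t₁ s₂ → Exec q s₂ t₂ s₃ → Exec (.seq p q) s₁ (t₁ + t₂) s₃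
  | branch_true {b : BExp} {p q : Prog} {s s' : Store} {t : ℕ} :
      b.Holds s → Exec p s t s' → Exec (.branch b p q) s (b.cost + 1 + t) s'
  | branch_false {b : BExp} {p q : Prog} {s s' : Store} {t : ℕ} :
      ¬ b.Holds s → Exec q s t s' → Exec (.branch b p q) s (b.cost + 1 + t) s'
  | loop_true {b : BExp} {p : Prog} {s₁ s₂ s₃ : Store} {t₁ t₂ : ℕ} :
      b.Holds s₁ → Exec p s₁ t₁ s₂ → Exec (.loop b p) s₂ t₂ s₃ →
        Exec (.loop b p) s₁ (b.cost + 1 + t₁ + t₂) s₃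
  | loop_false {b : BExp} {p : Prog} {s : Store} :
      ¬ b.Holds s → Exec (.loop b p) s (b.cost + 1) s

/-! ### Input and output conventions -/

namespace SemiMetricTSP

/-- The input of the reducer: `nat 0 [0, 0, 0]` holds the number of vertices, `real 0 [0, x, y]`
holds `w x y`, and all other cells hold zero. -/
noncomputable def inputStore (I : SemiMetricTSP) : Store where
  nat v i j l := if v = 0 ∧ i = 0 ∧ j = 0 ∧ l = 0 then I.n else 0
  real v i x y :=
    if h : v = 0 ∧ i = 0 ∧ x < I.n ∧ y < I.n then I.w ⟨x, h.2.2.1⟩ ⟨y, h.2.2.2⟩ else 0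

/-- The output of the reducer: the number `q` of instances is in `nat 1 [0, 0, 0]`, and for the
`j`-th one, `nat 2 [j, 0, 0]` holds its number of vertices and `real 1 [j, x, y]` the weight of
the edge from `x` to `y`. -/
def StoresInstances (s : Store) {q : ℕ} (J : Fin q → SemiMetricTSP) : Prop :=
  s.nat 1 0 0 0 = q ∧
    ∀ j : Fin q, s.nat 2 j 0 0 = (J j).n ∧ ∀ x y : Fin (J j).n, s.real 1 j x y = (J j).w x y

/-- The input of the merger: the memory `s` left by the reducer, with the solutions of the
instances written into the array `nat 3`: cell `[j, i, 0]` holds the `i`-th vertex on the tour in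
the `j`-th instance. -/
def withSolutions (s : Store) {q : ℕ} (J : Fin q → SemiMetricTSP) (S : ∀ j, (J j).Tour) : Store :=
  { s with nat := Function.update s.nat 3 fun j i l =>
      if l = 0 then
        if hj : j < q then
          if hi : i < (J ⟨j, hj⟩).n then (S ⟨j, hj⟩ ⟨i, hi⟩ : ℕ) else 0
        else 0
      else 0 }

/-- The output of the merger: `nat 4 [i, 0, 0]` holds the `i`-th vertex on the tour. -/
def StoresTour (s : Store) (I : SemiMetricTSP) (π : I.Tour) : Prop :=
  ∀ i : Fin I.n, s.nat 4 i 0 0 = (π i : ℕ)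

/-! ### Reductions -/

/-- `(reducer, merger)` is an `(r, f)`-reduction of Semi-Metric TSP of time complexity at most `T`
(as a function of the number of vertices). The reducer creates instances of size at most
`n / r + C`, where `C` is independent of the instance; from arbitrary solutions of these, the
merger computes a solution of the original instance, which is an `f α`-approximation whenever the
given solutions are `α`-approximations. -/
def IsReduction (r : ℝ) (f : ℝ → ℝ) (reducer merger : Prog) (T : ℕ → ℕ) : Prop :=
  ∃ C : ℝ, ∀ I : SemiMetricTSP,
    ∃ (t : ℕ) (s : Store) (q : ℕ) (J : Fin q → SemiMetricTSP),
      Exec reducer I.inputStore t s ∧ StoresInstances s J ∧ q ≤ T I.n ∧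
      (∀ j, ((J j).n : ℝ) ≤ (I.n : ℝ) / r + C) ∧
      ∀ S : ∀ j, (J j).Tour,
        ∃ (t' : ℕ) (s' : Store) (π : I.Tour),
          Exec merger (withSolutions s J S) t' s' ∧ t + t' ≤ T I.n ∧ StoresTour s' I π ∧
          ∀ α : ℝ, 1 ≤ α → (∀ j, (J j).weight (S j) ≤ α * (J j).opt) →
            I.weight π ≤ f α * I.opt

/-- There is a polynomial-time `(r, f)`-reduction of Semi-Metric TSP. -/
def HasPolyTimeReduction (r : ℝ) (f : ℝ → ℝ) : Prop :=
  ∃ (reducer merger : Prog) (p : Polynomial ℕ),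
    IsReduction r f reducer merger (fun n => p.eval n)

/-- There is a polynomial-time reduction scheme for Semi-Metric TSP with approximation `a (r, α)`,
for any rate `r ∈ R`, where `R` contains arbitrarily big rates. -/
def HasPolyTimeReductionScheme (R : Set ℝ) (a : ℝ → ℝ → ℝ) : Prop :=
  ¬ BddAbove R ∧ ∀ r ∈ R, HasPolyTimeReduction r (a r)

end SemiMetricTSP

/-!
The reduction makes `k` rounds of the following kind. On the set `A` of the remaining vertices, take
a cycle cover `σ` (a permutation without fixed points on `A`) of smallest weight and keep one vertex
of each cycle. As every cycle has at least two vertices, each round halves the number of vertices;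
only when a single vertex remains, `σ` is the identity and the vertex is kept. By the triangle
inequality, a tour can be shortcut to any set of vertices (`CyclicOn.exists_restrict`); hence each
cover weighs at most `OPT`, and so does an optimal tour of the instance that is left after `k`
rounds.

A tour on the vertices that are kept is encoded by the permutation `τ` that maps each vertex to its
successor and fixes all other vertices. Then `τ * σ` is a tour on `A`: it runs through each cycle up
to the predecessor of its chosen vertex and then continues with the successor of this vertex under
`τ` (`CyclicOn.mul`). Its weight is at most the sum of the weights of `σ` and `τ`
(`permCost_mul_le`). Over all rounds this adds `k * OPT = log₂ r * OPT` to the weight of the given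
solution, and the merger only has to follow the product of all these permutations.

A cycle cover of smallest weight is a minimum-weight assignment with forbidden pairs; it is computed
by the Hungarian method. The rows are inserted one by one, a row that has not been inserted yet
having cost zero in every column. Dual potentials certify optimality (`DualCertificate`), and each
insertion is a search for a shortest augmenting path by an alternating tree (`AlternatingTree`). The
machine has no real constant but zero, so that forbidden pairs cannot be given a large cost and are
stored in an array of their own. Instead of the tree, the program stores for each of its rows the
whole assignment that arises by shifting along the tree path, so that no path has to be followed.

The programs use only loops of the form `for c < n`. For such structured programs (`SProg`) the
final memory is a total function `SProg.run` of the initial memory, and the time is bounded by a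
polynomial that is read off the syntax (`SProg.exec_compile`); correctness is proved about
`SProg.run` with the invariant rule `SProg.run_forLt`.
-/

/-! ### Structured programs with bounded loops -/

namespace NExp

/-- The scalar variable `v`, that is, the cell `[0, 0, 0]` of the array `v`. -/
abbrev sc (v : ℕ) : NExp := .get v (.const 0) (.const 0) (.const 0)

end NExp

namespace BExp

/-- The test `a < b`. -/
abbrev natLt (a b : NExp) : BExp := .natLe (.add a (.const 1)) b

/-- The test `a = b`. -/
abbrev natEq (a b : NExp) : BExp := .and (.natLe a b) (.natLe b a)

end BExp

@[simp] theorem Store.setNat_nat (s : Store) (v i j l a v' i' j' l' : ℕ) :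
    (s.setNat v i j l a).nat v' i' j' l' =
      if v' = v ∧ i' = i ∧ j' = j ∧ l' = l then a else s.nat v' i' j' l' := rfl

@[simp] theorem Store.setNat_real (s : Store) (v i j l a : ℕ) :
    (s.setNat v i j l a).real = s.real := rfl

@[simp] theorem Store.setReal_real (s : Store) (v i j l : ℕ) (a : ℝ) (v' i' j' l' : ℕ) :
    (s.setReal v i j l a).real v' i' j' l' =
      if v' = v ∧ i' = i ∧ j' = j ∧ l' = l then a else s.real v' i' j' l' := rfl

@[simp] theorem Store.setReal_nat (s : Store) (v i j l : ℕ) (a : ℝ) :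
    (s.setReal v i j l a).nat = s.nat := rfl

theorem Store.setNat_nat_of_ne (s : Store) {v v' : ℕ} (i j l a : ℕ) (h : v' ≠ v) :
    (s.setNat v i j l a).nat v' = s.nat v' := by
  funext i' j' l'
  simp [h]

theorem Store.setReal_real_of_ne (s : Store) {v v' : ℕ} (i j l : ℕ) (a : ℝ) (h : v' ≠ v) :
    (s.setReal v i j l a).real v' = s.real v' := by
  funext i' j' l'
  simp [h]

/-- Programs whose only loops are counting loops: `forLt c p` runs `p` with the scalar variable `c`
equal to `0, 1, …, n - 1`, where `n` is the content of the scalar variable `0` (the size of the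
input). Such programs always halt, and in polynomial time. -/
inductive SProg : Type
  | skip
  | setNat (v : ℕ) (i j l : NExp) (e : NExp)
  | setReal (v : ℕ) (i j l : NExp) (e : RExp)
  | seq (p q : SProg)
  | branch (b : BExp) (p q : SProg)
  | forLt (c : ℕ) (p : SProg)

namespace SProg

/-- The machine program that implements a structured program. -/
def compile : SProg → Prog
  | skip => .skip
  | setNat v i j l e => .setNat v i j l e
  | setReal v i j l e => .setReal v i j l e
  | seq p q => .seq p.compile q.compile
  | branch b p q => .branch b p.compile q.compile
  | forLt c p =>
      .seq (.setNat c (.const 0) (.const 0) (.const 0) (.const 0))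
        (.loop (.natLt (.sc c) (.sc 0))
          (.seq p.compile
            (.setNat c (.const 0) (.const 0) (.const 0) (.add (.sc c) (.const 1)))))

/-- The state of a counting loop with counter `c` and body `F` after `k` passes. -/
def loopState (c : ℕ) (F : Store → Store) (s : Store) : ℕ → Store
  | 0 => s.setNat c 0 0 0 0
  | k + 1 => (F (loopState c F s k)).setNat c 0 0 0 (k + 1)

open Classical in
/-- The memory after the execution of a structured program. -/
noncomputable def run : SProg → Store → Store
  | skip, s => s
  | setNat v i j l e, s => s.setNat v (i.eval s) (j.eval s) (l.eval s) (e.eval s)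
  | setReal v i j l e, s => s.setReal v (i.eval s) (j.eval s) (l.eval s) (e.eval s)
  | seq p q, s => q.run (p.run s)
  | branch b p q, s => if b.Holds s then p.run s else q.run s
  | forLt c p, s => loopState c p.run s (s.nat 0 0 0 0)

/-- The arrays of natural numbers that a program may change. -/
def natWrites : SProg → List ℕ
  | skip => []
  | setNat v _ _ _ _ => [v]
  | setReal _ _ _ _ _ => []
  | seq p q => p.natWrites ++ q.natWrites
  | branch _ p q => p.natWrites ++ q.natWrites
  | forLt c p => c :: p.natWrites

/-- The arrays of real numbers that a program may change. -/
def realWrites : SProg → List ℕ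
  | skip => []
  | setNat _ _ _ _ _ => []
  | setReal v _ _ _ _ => [v]
  | seq p q => p.realWrites ++ q.realWrites
  | branch _ p q => p.realWrites ++ q.realWrites
  | forLt _ p => p.realWrites

/-- No loop body changes its own counter, and the size of the input is never changed. -/
def WellFormed : SProg → Bool
  | skip => true
  | setNat v _ _ _ _ => v != 0
  | setReal _ _ _ _ _ => true
  | seq p q => p.WellFormed && q.WellFormed
  | branch _ p q => p.WellFormed && q.WellFormed
  | forLt c p => c != 0 && !p.natWrites.contains c && p.WellFormed

open Polynomial in
/-- A bound for the running time in terms of the size of the input. -/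
noncomputable def time : SProg → Polynomial ℕ
  | skip => 1
  | setNat _ i j l e => (i.cost + j.cost + l.cost + e.cost + 1 : ℕ)
  | setReal _ i j l e => (i.cost + j.cost + l.cost + e.cost + 1 : ℕ)
  | seq p q => p.time + q.time
  | branch b p q => (b.cost + 1 : ℕ) + (p.time + q.time)
  | forLt _ p => X * (p.time + 22) + 17

theorem run_seq (p q : SProg) (s : Store) : (seq p q).run s = q.run (p.run s) := rfl

theorem run_nat_of_notMem (p : SProg) (s : Store) {v : ℕ} (h : v ∉ p.natWrites) :
    (p.run s).nat v = s.nat v := by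
  induction p generalizing s with
  | skip => rfl
  | setNat w i j l e =>
    exact s.setNat_nat_of_ne _ _ _ _ (by simpa [natWrites] using h)
  | setReal => rfl
  | seq p q hp hq =>
    simp only [natWrites, List.mem_append, not_or] at h
    exact (hq _ h.2).trans (hp _ h.1)
  | branch b p q hp hq =>
    simp only [natWrites, List.mem_append, not_or] at h
    unfold run
    split_ifs
    exacts [hp _ h.1, hq _ h.2]
  | forLt c p hp =>
    simp only [natWrites, List.mem_cons, not_or] at h
    unfold run
    induction s.nat 0 0 0 0 with
    | zero => exact s.setNat_nat_of_ne _ _ _ _ h.1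
    | succ k ih => exact ((Store.setNat_nat_of_ne _ _ _ _ _ h.1).trans (hp _ h.2)).trans ih

theorem run_real_of_notMem (p : SProg) (s : Store) {v : ℕ} (h : v ∉ p.realWrites) :
    (p.run s).real v = s.real v := by
  induction p generalizing s with
  | skip => rfl
  | setNat => rfl
  | setReal w i j l e =>
    exact s.setReal_real_of_ne _ _ _ _ (by simpa [realWrites] using h)
  | seq p q hp hq =>
    simp only [realWrites, List.mem_append, not_or] at h
    exact (hq _ h.2).trans (hp _ h.1)
  | branch b p q hp hq =>
    simp only [realWrites, List.mem_append, not_or] at h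
    unfold run
    split_ifs
    exacts [hp _ h.1, hq _ h.2]
  | forLt c p hp =>
    unfold run
    induction s.nat 0 0 0 0 with
    | zero => rfl
    | succ k ih => exact (hp _ h).trans ih

/-- The two memories agree except for the arrays that `p` may change. -/
structure AgreeOff (p : SProg) (s s' : Store) : Prop where
  nat : ∀ v, v ∉ p.natWrites → s'.nat v = s.nat v
  real : ∀ v, v ∉ p.realWrites → s'.real v = s.real v

theorem agreeOff_loopState (c : ℕ) (p : SProg) (s : Store) (k : ℕ) :
    AgreeOff (forLt c p) s (loopState c p.run s k) := by
  induction k with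
  | zero =>
    refine ⟨fun v h => s.setNat_nat_of_ne _ _ _ _ ?_, fun v _ => rfl⟩
    simp only [natWrites, List.mem_cons, not_or] at h
    exact h.1
  | succ k ih =>
    refine ⟨fun v h => ?_, fun v h => ?_⟩
    · have h' := h
      simp only [natWrites, List.mem_cons, not_or] at h'
      exact ((Store.setNat_nat_of_ne _ _ _ _ _ h'.1).trans
        (run_nat_of_notMem p _ h'.2)).trans (ih.nat v h)
    · exact (run_real_of_notMem p _ h).trans (ih.real v h)

/-- The invariant rule for counting loops. -/
theorem run_forLt {n c : ℕ} {p : SProg} {s : Store} (hn : s.nat 0 0 0 0 = n)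
    (Inv : ℕ → Store → Prop) (h₀ : Inv 0 (s.setNat c 0 0 0 0))
    (hstep : ∀ k (_ : k < n) (s' : Store), AgreeOff (forLt c p) s s' → s'.nat c 0 0 0 = k →
      Inv k s' → Inv (k + 1) ((p.run s').setNat c 0 0 0 (k + 1))) :
    Inv n ((forLt c p).run s) := by
  have key : ∀ k, k ≤ n → Inv k (loopState c p.run s k) := by
    intro k
    induction k with
    | zero => exact fun _ => h₀
    | succ k ih =>
      intro hk
      refine hstep k hk _ (agreeOff_loopState c p s k) ?_ (ih (Nat.le_of_succ_le hk))
      cases k <;> simp [loopState]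
  simpa only [run, hn] using key n le_rfl

theorem zero_notMem_natWrites {p : SProg} (hp : p.WellFormed = true) : 0 ∉ p.natWrites := by
  induction p with
  | skip | setReal => simp [natWrites]
  | setNat v =>
    simp only [WellFormed, bne_iff_ne] at hp
    simpa [natWrites] using hp.symm
  | seq p q ihp ihq | branch b p q ihp ihq =>
    simp only [WellFormed, Bool.and_eq_true] at hp
    simp [natWrites, ihp hp.1, ihq hp.2]
  | forLt c p ih =>
    simp only [WellFormed, Bool.and_eq_true, bne_iff_ne] at hp
    simp [natWrites, ih hp.2, hp.1.1.symm]

/-- A structured program is executed as specified, within its time bound. -/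
theorem exec_compile (p : SProg) (hp : p.WellFormed = true) (s : Store) :
    ∃ t, t ≤ p.time.eval (s.nat 0 0 0 0) ∧ Exec p.compile s t (p.run s) := by
  induction p generalizing s with
  | skip => exact ⟨1, by simp [time], .skip s⟩
  | setNat v i j l e => exact ⟨_, by simp [time], .setNat s v i j l e⟩
  | setReal v i j l e => exact ⟨_, by simp [time], .setReal s v i j l e⟩
  | seq p q ihp ihq =>
    simp only [WellFormed, Bool.and_eq_true] at hp
    obtain ⟨t, ht, he⟩ := ihp hp.1 s
    obtain ⟨t', ht', he'⟩ := ihq hp.2 (p.run s)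
    rw [run_nat_of_notMem p s (zero_notMem_natWrites hp.1)] at ht'
    exact ⟨t + t', by simpa [time] using add_le_add ht ht', .seq he he'⟩
  | branch b p q ihp ihq =>
    simp only [WellFormed, Bool.and_eq_true] at hp
    by_cases hb : b.Holds s
    · obtain ⟨t, ht, he⟩ := ihp hp.1 s
      refine ⟨b.cost + 1 + t, ?_, by simpa [run, hb, compile] using Exec.branch_true hb he⟩
      simp [time]
      lia
    · obtain ⟨t, ht, he⟩ := ihq hp.2 s
      refine ⟨b.cost + 1 + t, ?_, by simpa [run, hb, compile] using Exec.branch_false hb he⟩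
      simp [time]
      lia
  | forLt c p ih =>
    have hp₀ : 0 ∉ (forLt c p).natWrites := zero_notMem_natWrites hp
    simp only [WellFormed, Bool.and_eq_true, bne_iff_ne, Bool.not_eq_true',
      List.contains_eq_mem, decide_eq_false_iff_not] at hp
    obtain ⟨n, hn⟩ : ∃ n, s.nat 0 0 0 0 = n := ⟨_, rfl⟩
    have hcount : ∀ k, (loopState c p.run s k).nat c 0 0 0 = k := by
      rintro (_ | k) <;> simp [loopState]
    have hsize : ∀ k, (loopState c p.run s k).nat 0 0 0 0 = n := fun k => by
      rw [(agreeOff_loopState c p s k).nat 0 hp₀, hn]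
    -- the passes that remain when `n - d` passes have been made
    have hloop : ∀ d k, k + d = n → ∃ t, t ≤ d * (p.time.eval n + 22) + 12 ∧
        Exec (.loop (.natLt (.sc c) (.sc 0)) (.seq p.compile
          (.setNat c (.const 0) (.const 0) (.const 0) (.add (.sc c) (.const 1)))))
          (loopState c p.run s k) t (loopState c p.run s n) := by
      intro d
      induction d with
      | zero =>
        intro k hk
        obtain rfl : k = n := hk
        exact ⟨_, le_of_eq (by simp [BExp.cost, NExp.cost]),
          .loop_false (by simp [BExp.Holds, NExp.eval, hcount, hsize])⟩
      | succ d ihd =>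
        intro k hk
        obtain ⟨t, ht, he⟩ := ih hp.2 (loopState c p.run s k)
        obtain ⟨t', ht', he'⟩ := ihd (k + 1) (by lia)
        rw [hsize] at ht
        have hset := Exec.setNat (p.run (loopState c p.run s k)) c (.const 0) (.const 0) (.const 0)
          (.add (.sc c) (.const 1))
        have hval : (NExp.add (.sc c) (.const 1)).eval (p.run (loopState c p.run s k)) = k + 1 := by
          simp [NExp.eval, run_nat_of_notMem p _ hp.1.2, hcount]
        rw [hval] at hset
        refine ⟨_, ?_, .loop_true (by simp [BExp.Holds, NExp.eval, hcount, hsize]; lia)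
          (.seq he hset) he'⟩
        simp only [BExp.cost, NExp.cost]
        lia
    obtain ⟨t, ht, he⟩ := hloop n 0 (by simp)
    refine ⟨5 + t, ?_, .seq (t₁ := 5) (.setNat s c _ _ _ _) ?_⟩
    · simp only [time, hn, Polynomial.eval_add, Polynomial.eval_mul, Polynomial.eval_X,
        Polynomial.eval_ofNat]
      lia
    · rw [run, hn]
      exact he

end SProg

/-! ### Permutations with a single cycle on a set of vertices -/

open Equiv Finset

section Cyclic

variable {α : Type*}

/-- The permutation `ρ` permutes `A` in a single cycle and fixes all other points; it encodes a
directed Hamiltonian cycle on `A`. -/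
structure CyclicOn (ρ : Perm α) (A : Finset α) : Prop where
  fixes : ∀ x ∉ A, ρ x = x
  sameCycle : ∀ x ∈ A, ∀ y ∈ A, ρ.SameCycle x y

/-- The total weight of the arcs that leave `A` along the permutation `σ`. -/
def permCost (w : α → α → ℝ) (A : Finset α) (σ : Perm α) : ℝ := ∑ x ∈ A, w x (σ x)

theorem apply_mem_of_fixes {σ : Perm α} {A : Finset α} (h : ∀ x ∉ A, σ x = x) {x : α}
    (hx : x ∈ A) : σ x ∈ A := by
  by_contra h'
  rw [σ.injective (h _ h')] at h'
  exact h' hx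

theorem CyclicOn.isCycleOn {ρ : Perm α} {A : Finset α} (h : CyclicOn ρ A) : ρ.IsCycleOn A := by
  refine ⟨⟨fun x hx => apply_mem_of_fixes h.fixes hx, ρ.injective.injOn, fun x hx => ?_⟩,
    fun x hx y hy => h.sameCycle x hx y hy⟩
  refine ⟨ρ.symm x, ?_, by simp⟩
  by_contra h'
  have := h.fixes _ h'
  rw [Equiv.apply_symm_apply] at this
  exact h' (this ▸ hx)

/-- Skipping one vertex of a cycle does not increase its weight. -/
theorem CyclicOn.exists_erase [Finite α] [DecidableEq α]
    {w : α → α → ℝ} (hw : ∀ x y z, w x z ≤ w x y + w y z)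
    {ρ : Perm α} {A : Finset α} (h : CyclicOn ρ A) {x : α} (hx : x ∈ A) :
    ∃ ρ' : Perm α, CyclicOn ρ' (A.erase x) ∧ permCost w (A.erase x) ρ' ≤ permCost w A ρ := by
  set ρ' : Perm α := swap x (ρ x) * ρ with hρ'
  have hx' : ρ' x = x := by simp [hρ']
  have hpred : ∀ z, ρ z = x → ρ' z = ρ x := fun z hz => by simp [hρ', hz]
  have hother : ∀ z, z ≠ x → ρ z ≠ x → ρ' z = ρ z := fun z hz hz' => by
    rw [hρ', Perm.mul_apply, swap_apply_of_ne_of_ne hz' (fun e => hz (ρ.injective e))]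
  refine ⟨ρ', ⟨fun z hz => ?_, fun y hy z hz => ?_⟩, ?_⟩
  · by_cases hzx : z = x
    · rw [hzx, hx']
    · have hzA : z ∉ A := fun h' => hz (mem_erase.2 ⟨hzx, h'⟩)
      rw [hother z hzx (by rwa [h.fixes z hzA]), h.fixes z hzA]
  · rw [mem_erase] at hy hz
    have hne : ρ x ≠ x := fun e => by
      obtain ⟨i, hi⟩ := h.sameCycle x hx y hy.2
      rw [Perm.zpow_apply_eq_self_of_apply_eq_self e] at hi
      exact hy.1 hi.symm
    -- the cycle of `ρ` is followed from `y`, with `x` replaced by its successor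
    have key : ∀ i : ℕ, ρ'.SameCycle y (if (ρ ^ i) y = x then ρ x else (ρ ^ i) y) := by
      intro i
      induction i with
      | zero => simp [hy.1, Perm.SameCycle.rfl]
      | succ i ih =>
        rw [pow_succ', Perm.mul_apply]
        by_cases h₁ : (ρ ^ i) y = x
        · simpa [h₁, hne] using ih
        · rw [if_neg h₁] at ih
          split_ifs with h₂
          · rw [← hpred _ h₂]
            exact Perm.sameCycle_apply_right.2 ih
          · rw [← hother _ h₁ h₂]
            exact Perm.sameCycle_apply_right.2 ih
    obtain ⟨i, hi⟩ := (h.sameCycle y hy.2 z hz.2).exists_nat_pow_eq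
    have := key i
    rwa [hi, if_neg hz.1] at this
  · unfold permCost
    have hp : ρ (ρ.symm x) = x := by simp
    by_cases hpx : ρ.symm x = x
    · rw [hpx] at hp
      have hsame : ∀ z, ρ' z = ρ z := fun z => by simp [hρ', hp]
      rw [← add_sum_erase A _ hx]
      simp only [hsame, hp]
      linarith [hw x x x]
    · have hpA : ρ.symm x ∈ A.erase x := by
        refine mem_erase.2 ⟨hpx, ?_⟩
        by_contra h'
        have := h.fixes _ h'
        rw [hp] at this
        exact hpx this.symm
      rw [← add_sum_erase A _ hx, ← add_sum_erase _ _ hpA, ← add_sum_erase _ (fun y => w y (ρ y)) hpA,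
        hpred _ hp, hp]
      have hrest : ∑ z ∈ (A.erase x).erase (ρ.symm x), w z (ρ' z) =
          ∑ z ∈ (A.erase x).erase (ρ.symm x), w z (ρ z) := by
        refine sum_congr rfl fun z hz => ?_
        simp only [mem_erase] at hz
        rw [hother z hz.2.1 fun e => hz.1 (by rw [← e, Equiv.symm_apply_apply])]
      rw [hrest]
      linarith [hw (ρ.symm x) x (ρ x)]

/-- Shortcutting: the restriction of a cycle to a subset of its vertices does not weigh more. -/
theorem CyclicOn.exists_restrict [Finite α] [DecidableEq α]
    {w : α → α → ℝ} (hw : ∀ x y z, w x z ≤ w x y + w y z)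
    {B : Finset α} (A : Finset α) (hBA : B ⊆ A) (ρ : Perm α) (h : CyclicOn ρ A) :
    ∃ ρ' : Perm α, CyclicOn ρ' B ∧ permCost w B ρ' ≤ permCost w A ρ := by
  induction A using Finset.strongInduction generalizing ρ with
  | H A ih =>
    by_cases hAB : A ⊆ B
    · obtain rfl := hBA.antisymm hAB
      exact ⟨ρ, h, le_rfl⟩
    · obtain ⟨x, hx, hxB⟩ := not_subset.1 hAB
      obtain ⟨ρ₁, h₁, hc₁⟩ := h.exists_erase hw hx
      obtain ⟨ρ₂, h₂, hc₂⟩ := ih _ (erase_ssubset hx)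
        (fun y hy => mem_erase.2 ⟨fun e => hxB (e ▸ hy), hBA hy⟩) ρ₁ h₁
      exact ⟨ρ₂, h₂, hc₂.trans hc₁⟩

/-- If `B` contains exactly one vertex of each cycle of `σ` on `A`, and `τ` is a cycle on `B`, then
`τ * σ` is a cycle on `A`: it follows each cycle of `σ` up to the predecessor of its vertex in `B`,
and then moves on to the successor of this vertex under `τ`. -/
theorem CyclicOn.mul [Finite α] {σ τ : Perm α} {A B : Finset α} (hBA : B ⊆ A) (hσ : ∀ x ∉ A, σ x = x)
    (hex : ∀ x ∈ A, ∃ y ∈ B, σ.SameCycle y x)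
    (huniq : ∀ x ∈ B, ∀ y ∈ B, σ.SameCycle x y → x = y) (hτ : CyclicOn τ B) :
    CyclicOn (τ * σ) A := by
  have hrep : ∀ x ∈ B, ∀ y, σ.SameCycle x y → (τ * σ).SameCycle x y := by
    intro x hx y hy
    obtain ⟨i, rfl⟩ := hy.exists_nat_pow_eq
    clear hy
    induction i with
    | zero => exact .refl _ _
    | succ i ih =>
      rw [pow_succ', Perm.mul_apply]
      by_cases hB : σ ((σ ^ i) x) ∈ B
      · rw [← huniq x hx _ hB ⟨i + 1, by rw [add_comm]; simp [zpow_add]⟩]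
      · have : σ ((σ ^ i) x) = (τ * σ) ((σ ^ i) x) := by
          rw [Perm.mul_apply, hτ.fixes _ hB]
        rw [this]
        exact Perm.sameCycle_apply_right.2 ih
  have hnext : ∀ x ∈ B, (τ * σ).SameCycle x (τ x) := by
    intro x hx
    have h₁ := hrep x hx (σ.symm x) (Perm.sameCycle_symm_apply_right.2 (.refl _ _))
    have h₂ := Perm.sameCycle_apply_right.2 h₁
    rwa [Perm.mul_apply, Equiv.apply_symm_apply] at h₂
  have hBB : ∀ x ∈ B, ∀ y ∈ B, (τ * σ).SameCycle x y := by
    intro x hx y hy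
    obtain ⟨i, rfl⟩ := (hτ.sameCycle x hx y hy).exists_nat_pow_eq
    clear hy
    induction i with
    | zero => exact .refl _ _
    | succ i ih =>
      rw [pow_succ', Perm.mul_apply]
      refine ih.trans (hnext _ ?_)
      clear ih
      induction i with
      | zero => exact hx
      | succ i ih =>
        rw [pow_succ', Perm.mul_apply]
        exact apply_mem_of_fixes hτ.fixes ih
  refine ⟨fun x hx => ?_, fun x hx y hy => ?_⟩
  · rw [Perm.mul_apply, hσ x hx, hτ.fixes x fun h => hx (hBA h)]
  · obtain ⟨x', hx', hxx⟩ := hex x hx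
    obtain ⟨y', hy', hyy⟩ := hex y hy
    exact ((hrep x' hx' x hxx).symm.trans (hBB x' hx' y' hy')).trans (hrep y' hy' y hyy)

theorem permCost_mul_le [DecidableEq α]
    {w : α → α → ℝ} (hw : ∀ x y z, w x z ≤ w x y + w y z)
    {σ τ : Perm α} {A B : Finset α} (hBA : B ⊆ A) (hσ : ∀ x ∉ A, σ x = x)
    (hτ : ∀ x ∉ B, τ x = x) :
    permCost w A (τ * σ) ≤ permCost w A σ + permCost w B τ := by
  have h₁ : permCost w B τ = ∑ x ∈ A, if σ x ∈ B then w (σ x) (τ (σ x)) else 0 := by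
    rw [sum_equiv σ (t := A) (g := fun y => if y ∈ B then w y (τ y) else 0) (fun x => ?_)
      (fun x _ => rfl)]
    · rw [sum_ite_mem, inter_eq_right.2 hBA, permCost]
    · refine ⟨apply_mem_of_fixes hσ, fun hx => ?_⟩
      by_contra h'
      rw [hσ x h'] at hx
      exact h' hx
  rw [h₁, permCost, permCost, ← sum_add_distrib]
  refine sum_le_sum fun x _ => ?_
  rw [Perm.mul_apply]
  split_ifs with hB
  · exact hw _ _ _
  · rw [hτ _ hB, add_zero]

theorem CyclicOn.viaEmbedding {β : Type*} [Fintype β] {g : Perm β} (hg : CyclicOn g univ)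
    (e : β ↪ α) : CyclicOn (g.viaEmbedding e) (univ.map e) := by
  have hpow : ∀ (i : ℕ) x, (g.viaEmbedding e ^ i) (e x) = e ((g ^ i) x) := by
    intro i x
    induction i with
    | zero => rfl
    | succ i ih =>
      rw [pow_succ', pow_succ', Perm.mul_apply, Perm.mul_apply, ih, Perm.viaEmbedding_apply]
  refine ⟨fun x hx => Perm.viaEmbedding_apply_of_notMem _ _ _ (by simpa using hx), ?_⟩
  simp only [mem_map, mem_univ, true_and]
  rintro _ ⟨x, rfl⟩ _ ⟨y, rfl⟩
  obtain ⟨i, hi⟩ := (hg.sameCycle x (mem_univ x) y (mem_univ y)).exists_nat_pow_eq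
  exact ⟨i, by rw [zpow_natCast, hpow, hi]⟩

theorem permCost_viaEmbedding {β : Type*} [Fintype β] (w : α → α → ℝ) (g : Perm β) (e : β ↪ α) :
    permCost w (univ.map e) (g.viaEmbedding e) = permCost (fun x y => w (e x) (e y)) univ g := by
  unfold permCost
  rw [sum_map]
  exact sum_congr rfl fun x _ => by rw [Perm.viaEmbedding_apply]

end Cyclic

section Representatives

variable {n : ℕ}

open Classical in
/-- The smallest vertices of the cycles of `σ` on `A`. -/
noncomputable def cycleMinima (σ : Perm (Fin n)) (A : Finset (Fin n)) : Finset (Fin n) :=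
  {x ∈ A | ∀ y, σ.SameCycle x y → x ≤ y}

theorem mem_cycleMinima {σ : Perm (Fin n)} {A : Finset (Fin n)} {x : Fin n} :
    x ∈ cycleMinima σ A ↔ x ∈ A ∧ ∀ y, σ.SameCycle x y → x ≤ y := by
  simp [cycleMinima]

theorem cycleMinima_subset (σ : Perm (Fin n)) (A : Finset (Fin n)) : cycleMinima σ A ⊆ A :=
  fun _ h => (mem_cycleMinima.1 h).1

theorem exists_mem_cycleMinima {σ : Perm (Fin n)} {A : Finset (Fin n)} (hσ : ∀ x ∉ A, σ x = x)
    {x : Fin n} (hx : x ∈ A) : ∃ y ∈ cycleMinima σ A, σ.SameCycle y x := by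
  classical
  obtain ⟨y, hy, hmin⟩ := exists_min_image {y | σ.SameCycle x y} id ⟨x, by simp [Perm.SameCycle.rfl]⟩
  simp only [mem_filter, mem_univ, true_and, id] at hy hmin
  refine ⟨y, mem_cycleMinima.2 ⟨?_, fun z hz => hmin z (hy.trans hz)⟩, hy.symm⟩
  by_contra h
  obtain ⟨i, hi⟩ := hy.symm
  rw [Perm.zpow_apply_eq_self_of_apply_eq_self (hσ y h)] at hi
  exact h (hi ▸ hx)

theorem eq_of_mem_cycleMinima {σ : Perm (Fin n)} {A : Finset (Fin n)} {x y : Fin n}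
    (hx : x ∈ cycleMinima σ A) (hy : y ∈ cycleMinima σ A) (h : σ.SameCycle x y) : x = y :=
  le_antisymm ((mem_cycleMinima.1 hx).2 y h) ((mem_cycleMinima.1 hy).2 x h.symm)

/-- The successors of the cycle minima are not minima, so that there are at least as many vertices
of the second kind as of the first. -/
theorem two_mul_card_cycleMinima_le {σ : Perm (Fin n)} {A : Finset (Fin n)}
    (hσ : ∀ x ∉ A, σ x = x) (hA : ∀ x ∈ A, σ x ≠ x) : 2 * #(cycleMinima σ A) ≤ #A := by
  have h₁ : #(cycleMinima σ A) ≤ #(A \ cycleMinima σ A) := by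
    refine card_le_card_of_injOn σ (fun x hx => ?_) σ.injective.injOn
    have hx := mem_coe.1 hx
    have hxA := cycleMinima_subset σ A hx
    exact mem_coe.2 (mem_sdiff.2 ⟨apply_mem_of_fixes hσ hxA, fun h => hA x hxA
      (eq_of_mem_cycleMinima hx h (Perm.sameCycle_apply_right.2 (.refl _ _))).symm⟩)
  have h₂ := card_sdiff_add_card_eq_card (cycleMinima_subset σ A)
  lia

end Representatives

/-! ### Tours as cyclic permutations -/

/-- A cyclic permutation of all vertices gives the tour `z, g z, g² z, …`. -/
theorem CyclicOn.exists_order {n : ℕ} {g : Perm (Fin n)} (hg : CyclicOn g univ) (z : Fin n) :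
    ∃ π : Perm (Fin n), (∀ i, π i = (g ^ (i : ℕ)) z) ∧ ∀ i, π (finRotate n i) = g (π i) := by
  have hc := hg.isCycleOn
  have hsurj : Function.Surjective fun i : Fin n => (g ^ (i : ℕ)) z := fun y => by
    obtain ⟨i, hi, h⟩ := hc.exists_pow_eq (mem_univ z) (mem_univ y)
    exact ⟨⟨i, by simpa using hi⟩, h⟩
  refine ⟨.ofBijective _ (Finite.surjective_iff_bijective.1 hsurj), fun i => rfl, fun i => ?_⟩
  simp only [ofBijective_apply]
  obtain _ | n := n
  · exact z.elim0
  · rw [← Perm.mul_apply, ← pow_succ']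
    by_cases hi : i = Fin.last n
    · have := hc.pow_card_apply (mem_univ z)
      rw [card_univ, Fintype.card_fin] at this
      simp [hi, this]
    · rw [coe_finRotate_of_ne_last hi]

theorem sameCycle_finRotate (n : ℕ) (x y : Fin n) : (finRotate n).SameCycle x y := by
  obtain _ | n := n
  · exact x.elim0
  have h : ∀ i : ℕ, ∀ hi : i < n + 1, (finRotate (n + 1)).SameCycle 0 ⟨i, hi⟩ := by
    intro i
    induction i with
    | zero => exact fun _ => .refl _ _
    | succ i ih =>
      intro hi
      rw [← finRotate_of_lt (by lia : i < n)]
      exact Perm.sameCycle_apply_right.2 (ih (by lia))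
  exact (h x x.2).symm.trans (h y y.2)

namespace SemiMetricTSP

variable (I : SemiMetricTSP)

/-- The permutation that maps each vertex to its successor on the tour. -/
def next {I : SemiMetricTSP} (π : I.Tour) : Perm (Fin I.n) := π * finRotate I.n * π⁻¹

theorem next_apply {I : SemiMetricTSP} (π : I.Tour) (i : Fin I.n) :
    next π (π i) = π (finRotate I.n i) := by
  simp [next]

theorem weight_eq_permCost {I : SemiMetricTSP} (π : I.Tour) {g : Perm (Fin I.n)}
    (h : ∀ i, π (finRotate I.n i) = g (π i)) : I.weight π = permCost I.w univ g := by
  rw [weight, permCost, ← Equiv.sum_comp π fun x => I.w x (g x)]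
  simp only [h]

theorem cyclicOn_next {I : SemiMetricTSP} (π : I.Tour) : CyclicOn (next π) univ := by
  refine ⟨fun x hx => absurd (mem_univ x) hx, fun x _ y _ => ?_⟩
  rw [next, Perm.sameCycle_conj]
  exact sameCycle_finRotate _ _ _

theorem opt_le (π : I.Tour) : I.opt ≤ I.weight π := inf'_le _ (mem_univ π)

theorem opt_le_permCost {g : Perm (Fin I.n)} (hg : CyclicOn g univ) :
    I.opt ≤ permCost I.w univ g := by
  rcases isEmpty_or_nonempty (Fin I.n) with h | ⟨⟨z⟩⟩
  · exact (I.opt_le 1).trans_eq (weight_eq_permCost _ fun i => h.elim i)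
  · obtain ⟨π, -, hπ⟩ := hg.exists_order z
    exact (I.opt_le π).trans_eq (weight_eq_permCost π hπ)

/-- An optimal tour, shortcut to a set `A` of vertices. -/
theorem exists_cyclicOn_permCost_le_opt (A : Finset (Fin I.n)) :
    ∃ ρ : Perm (Fin I.n), CyclicOn ρ A ∧ permCost I.w A ρ ≤ I.opt := by
  obtain ⟨π, -, hπ⟩ := exists_mem_eq_inf' (s := (univ : Finset I.Tour)) univ_nonempty I.weight
  obtain ⟨ρ, hρ, hc⟩ := (cyclicOn_next π).exists_restrict I.triangle univ (subset_univ A)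
  refine ⟨ρ, hρ, hc.trans_eq ?_⟩
  rw [← weight_eq_permCost π fun i => (next_apply π i).symm, opt, hπ]

/-- The instance on the vertices in the range of `e`. -/
def induced {m : ℕ} (e : Fin m ↪ Fin I.n) : SemiMetricTSP where
  n := m
  w x y := I.w (e x) (e y)
  triangle _ _ _ := I.triangle _ _ _

theorem opt_induced_le {m : ℕ} (e : Fin m ↪ Fin I.n) : (I.induced e).opt ≤ I.opt := by
  obtain ⟨ρ, hρ, hc⟩ := I.exists_cyclicOn_permCost_le_opt (univ.map e)
  have hmem : ∀ x : Fin m, ρ (e x) ∈ univ.map e := fun x =>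
    apply_mem_of_fixes hρ.fixes (mem_map_of_mem e (mem_univ x))
  choose f _ hf using fun x => mem_map.1 (hmem x)
  have hinj : Function.Injective f := fun x y h => by
    have := hf x
    rw [h, hf y] at this
    exact (e.injective (ρ.injective this)).symm
  set g : Perm (Fin m) := .ofBijective f (Finite.injective_iff_bijective.1 hinj)
  have hg : ∀ (i : ℕ) x, e ((g ^ i) x) = (ρ ^ i) (e x) := by
    intro i x
    induction i with
    | zero => rfl
    | succ i ih => rw [pow_succ', pow_succ', Perm.mul_apply, Perm.mul_apply, ← ih]; exact hf _
  have hcyc : CyclicOn g univ := by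
    refine ⟨fun x hx => absurd (mem_univ x) hx, fun x _ y _ => ?_⟩
    obtain ⟨i, hi⟩ := (hρ.sameCycle (e x) (mem_map_of_mem e (mem_univ x)) (e y)
      (mem_map_of_mem e (mem_univ y))).exists_nat_pow_eq
    exact ⟨i, e.injective (by rw [zpow_natCast, hg, hi])⟩
  refine ((I.induced e).opt_le_permCost hcyc).trans (le_trans (le_of_eq ?_) hc)
  unfold permCost
  rw [sum_map]
  exact sum_congr rfl fun x _ => congrArg (I.w (e x)) (hf x)

end SemiMetricTSP

/-! ### Minimum-weight assignments: certificates and alternating trees -/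

section Assignment

variable {n : ℕ} {c : Fin n → Fin n → ℝ} {E : Fin n → Fin n → Prop}
  {σ : Perm (Fin n)} {u v u' v' : Fin n → ℝ}

/-- The potentials `u` (of the rows) and `v` (of the columns) are a feasible solution of the linear
program dual to the assignment problem with costs `c` and admissible pairs `E`, and `σ` is an
admissible assignment that satisfies the complementary slackness conditions. -/
structure DualCertificate (c : Fin n → Fin n → ℝ) (E : Fin n → Fin n → Prop) (u v : Fin n → ℝ)
    (σ : Perm (Fin n)) : Prop where
  feasible : ∀ x y, E x y → 0 ≤ c x y - u x - v y
  admissible : ∀ x, E x (σ x)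
  tight : ∀ x, c x (σ x) - u x - v (σ x) = 0

theorem DualCertificate.sum_le (h : DualCertificate c E u v σ) {ρ : Perm (Fin n)}
    (hρ : ∀ x, E x (ρ x)) : ∑ x, c x (σ x) ≤ ∑ x, c x (ρ x) := by
  have h₁ : ∑ x, (c x (σ x) - u x - v (σ x)) = 0 := sum_eq_zero fun x _ => h.tight x
  have h₂ : 0 ≤ ∑ x, (c x (ρ x) - u x - v (ρ x)) :=
    sum_nonneg fun x _ => h.feasible x _ (hρ x)
  simp only [sum_sub_distrib, Equiv.sum_comp σ v, Equiv.sum_comp ρ v] at h₁ h₂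
  linarith

/-- The search for a shortest augmenting path from the row `m`. The assignment `σ` is tight in all
rows but `m`. The tree has the set of rows `T` and the columns `σ l` for `l ∈ T`, `l ≠ m`; instead
of the path from `m` to a row `i ∈ T` we keep the assignment `M i` that arises from `σ` by shifting
along this path, so that `i` is the only row that need not be tight, and is assigned the free column
`σ m`. In the beginning, when `T = {m}`, the potential of the row `m` is arbitrary. -/
structure AlternatingTree (c : Fin n → Fin n → ℝ) (E : Fin n → Fin n → Prop) (σ : Perm (Fin n))
    (m : Fin n) (u v : Fin n → ℝ) (T : Finset (Fin n)) (M : Fin n → Perm (Fin n)) : Prop where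
  root_mem : m ∈ T
  free : ∀ i ∈ T, M i i = σ m
  off : ∀ i ∈ T, ∀ l ∉ T, M i l = σ l
  feasible : ∀ x, (x = m → ∃ l ∈ T, l ≠ m) → ∀ y, E x y → 0 ≤ c x y - u x - v y
  admissible : ∀ i ∈ T, ∀ x ≠ i, E x (M i x)
  tight : ∀ i ∈ T, ∀ x ≠ i, c x (M i x) - u x - v (M i x) = 0

/-- The admissible pairs `(i, σ l)` of a row in the tree and a column that is not in the tree. -/
def LeavesTree (E : Fin n → Fin n → Prop) (σ : Perm (Fin n)) (m : Fin n) (T : Finset (Fin n))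
    (i l : Fin n) : Prop :=
  i ∈ T ∧ (l ∉ T ∨ l = m) ∧ E i (σ l)

variable {m : Fin n} {T : Finset (Fin n)} {M : Fin n → Perm (Fin n)}

/-- If there is an admissible assignment at all, then the rows of the tree have an admissible column
outside the tree, as the tree has fewer columns than rows. -/
theorem exists_leavesTree (hm : m ∈ T) {ρ : Perm (Fin n)} (hρ : ∀ x, E x (ρ x)) :
    ∃ i l, LeavesTree E σ m T i l := by
  by_contra! hno
  have hsub : T.map ρ.toEmbedding ⊆ (T.erase m).map σ.toEmbedding := by
    intro y hy
    obtain ⟨i, hi, rfl⟩ := mem_map.1 hy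
    refine mem_map.2 ⟨σ.symm (ρ i), ?_, by simp⟩
    by_contra h'
    refine hno i (σ.symm (ρ i)) ⟨hi, ?_, by simpa using hρ i⟩
    by_contra! h''
    exact h' (mem_erase.2 ⟨h''.2, h''.1⟩)
  have h₁ := card_le_card hsub
  rw [card_map, card_map, card_erase_of_mem hm] at h₁
  have := card_pos.2 ⟨m, hm⟩
  lia

/-- Activating the row `m`: only this row of the costs and of the admissible pairs has changed. -/
theorem DualCertificate.alternatingTree {c₀ : Fin n → Fin n → ℝ} {E₀ : Fin n → Fin n → Prop}
    (h : DualCertificate c₀ E₀ u v σ) (hc : ∀ x ≠ m, ∀ y, c x y = c₀ x y)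
    (hE : ∀ x ≠ m, ∀ y, E x y ↔ E₀ x y) (hM : M m = σ) :
    AlternatingTree c E σ m u v {m} M where
  root_mem := by simp
  free := by simp [hM]
  off := by simp [hM]
  feasible x hx y hy := by
    have hxm : x ≠ m := fun e => by simpa using hx e
    rw [hc x hxm]
    exact h.feasible x y ((hE x hxm y).1 hy)
  admissible := by
    simp only [mem_singleton, forall_eq, hM]
    exact fun x hx => (hE x hx _).2 (h.admissible x)
  tight := by
    simp only [mem_singleton, forall_eq, hM]
    intro x hx
    rw [hc x hx]
    exact h.tight x

/-- For a row `i` of the tree, the assignment `M i` maps the other rows of the tree to its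
columns. -/
theorem AlternatingTree.symm_apply_mem (h : AlternatingTree c E σ m u v T M) {i x : Fin n}
    (hi : i ∈ T) (hx : x ≠ i) :
    (σ.symm (M i x) ∈ T ∧ σ.symm (M i x) ≠ m) ↔ x ∈ T := by
  constructor
  · rintro ⟨h₁, -⟩
    by_contra hxT
    rw [h.off i hi x hxT, symm_apply_apply] at h₁
    exact hxT h₁
  · refine fun hxT => ⟨?_, fun e => ?_⟩
    · by_contra h'
      have := h.off i hi _ h'
      rw [apply_symm_apply] at this
      rw [(M i).injective this] at h'
      exact h' hxT
    · rw [symm_apply_eq, ← h.free i hi] at e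
      exact hx ((M i).injective e)

section Update

variable (h : AlternatingTree c E σ m u v T M) {i₀ l₀ : Fin n} (h₀ : LeavesTree E σ m T i₀ l₀)
  (hmin : ∀ i l, LeavesTree E σ m T i l →
    c i₀ (σ l₀) - u i₀ - v (σ l₀) ≤ c i (σ l) - u i - v (σ l))
  (hu : ∀ x, u' x = if x ∈ T then u x + (c i₀ (σ l₀) - u i₀ - v (σ l₀)) else u x)
  (hv : ∀ l, v' (σ l) =
    if l ∈ T ∧ l ≠ m then v (σ l) - (c i₀ (σ l₀) - u i₀ - v (σ l₀)) else v (σ l))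

include hu hv

include h in
theorem AlternatingTree.tight_update {i x : Fin n} (hi : i ∈ T) (hx : x ≠ i) :
    c x (M i x) - u' x - v' (M i x) = 0 := by
  have hv' := hv (σ.symm (M i x))
  simp only [apply_symm_apply, h.symm_apply_mem hi hx] at hv'
  have := h.tight i hi x hx
  rw [hu, hv']
  split_ifs <;> linarith

include h₀

/-- The pair of smallest slack becomes tight. -/
theorem tight_update_edge : c i₀ (σ l₀) - u' i₀ - v' (σ l₀) = 0 := by
  have hl : ¬ (l₀ ∈ T ∧ l₀ ≠ m) := by
    have := h₀.2.1
    tauto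
  rw [hu, hv, if_pos h₀.1, if_neg hl]
  ring

include h hmin

/-- The change of the potentials by the smallest slack of a pair that leaves the tree makes them
feasible. -/
theorem AlternatingTree.feasible_update (x y : Fin n) (hxy : E x y) : 0 ≤ c x y - u' x - v' y := by
  obtain ⟨l, rfl⟩ := σ.surjective y
  rw [hu, hv]
  by_cases hl : l ∈ T ∧ l ≠ m
  · have hex : ∃ l ∈ T, l ≠ m := ⟨l, hl⟩
    have hpos := h.feasible i₀ (fun _ => hex) _ h₀.2.2
    have := h.feasible x (fun _ => hex) _ hxy
    rw [if_pos hl]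
    split_ifs <;> linarith
  · rw [if_neg hl]
    split_ifs with hx
    · have := hmin x l ⟨hx, by tauto, hxy⟩
      linarith
    · exact h.feasible x (fun e => absurd (e ▸ h.root_mem) hx) _ hxy

/-- When the free column is reached, the shifted assignment is tight in all rows. -/
theorem AlternatingTree.dualCertificate (hl₀ : l₀ = m) : DualCertificate c E u' v' (M i₀) where
  feasible := h.feasible_update h₀ hmin hu hv
  admissible x := by
    by_cases hx : x = i₀
    · rw [hx]
      have := h₀.2.2
      rwa [hl₀, ← h.free i₀ h₀.1] at this
    · exact h.admissible i₀ h₀.1 x hx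
  tight x := by
    by_cases hx : x = i₀
    · rw [hx]
      have := tight_update_edge h₀ hu hv
      rwa [hl₀, ← h.free i₀ h₀.1] at this
    · exact h.tight_update hu hv h₀.1 hx

/-- When another column `σ l₀` is reached, the row `l₀` joins the tree. -/
theorem AlternatingTree.insert (hl₀ : l₀ ≠ m) :
    AlternatingTree c E σ m u' v' (insert l₀ T) (Function.update M l₀ (M i₀ * swap i₀ l₀)) := by
  have hlT : l₀ ∉ T := h₀.2.1.resolve_right hl₀
  have hi₀ : i₀ ≠ l₀ := fun e => hlT (e ▸ h₀.1)
  have hold : ∀ i ∈ T, Function.update M l₀ (M i₀ * swap i₀ l₀) i = M i := fun i hi =>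
    Function.update_of_ne (fun e => hlT (by rwa [e] at hi)) _ _
  have hM : (M i₀ * swap i₀ l₀) i₀ = σ l₀ := by
    rw [Perm.mul_apply, swap_apply_left, h.off i₀ h₀.1 l₀ hlT]
  have hrest : ∀ x, x ≠ i₀ → x ≠ l₀ → (M i₀ * swap i₀ l₀) x = M i₀ x := fun x hx hx' => by
    rw [Perm.mul_apply, swap_apply_of_ne_of_ne hx hx']
  refine ⟨mem_insert_of_mem h.root_mem, ?_, ?_,
    fun x _ => h.feasible_update h₀ hmin hu hv x, ?_, ?_⟩
  · refine (forall_mem_insert _ _ _).2 ⟨?_, fun i hi => ?_⟩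
    · rw [Function.update_self, Perm.mul_apply, swap_apply_right, h.free _ h₀.1]
    · rw [hold i hi, h.free i hi]
  · refine (forall_mem_insert _ _ _).2 ⟨fun l hl => ?_, fun i hi l hl => ?_⟩ <;>
      rw [mem_insert, not_or] at hl
    · rw [Function.update_self, hrest l (fun e => hl.2 (e ▸ h₀.1)) hl.1, h.off _ h₀.1 l hl.2]
    · rw [hold i hi, h.off i hi l hl.2]
  · refine (forall_mem_insert _ _ _).2 ⟨fun x hx => ?_, fun i hi x hx => ?_⟩
    · rw [Function.update_self]
      by_cases hx' : x = i₀
      · rw [hx', hM]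
        exact h₀.2.2
      · rw [hrest x hx' hx]
        exact h.admissible _ h₀.1 x hx'
    · rw [hold i hi]
      exact h.admissible i hi x hx
  · refine (forall_mem_insert _ _ _).2 ⟨fun x hx => ?_, fun i hi x hx => ?_⟩
    · rw [Function.update_self]
      by_cases hx' : x = i₀
      · rw [hx', hM]
        exact tight_update_edge h₀ hu hv
      · rw [hrest x hx' hx]
        exact h.tight_update hu hv h₀.1 hx'
    · rw [hold i hi]
      exact h.tight_update hu hv hi hx

end Update

end Assignment

/-! ### Cycle covers -/

section CycleCover

variable {n : ℕ}

/-- The pairs that a cycle cover of `A` may use: loops at the other vertices, and the arcs between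
distinct vertices of `A`. If `A` has at most one vertex, then loops are admitted everywhere. -/
def CoverPair (A : Finset (Fin n)) (x y : Fin n) : Prop :=
  if x = y then x ∉ A ∨ #A ≤ 1 else x ∈ A ∧ y ∈ A

theorem CyclicOn.coverPair {ρ : Perm (Fin n)} {A : Finset (Fin n)} (h : CyclicOn ρ A)
    (x : Fin n) : CoverPair A x (ρ x) := by
  unfold CoverPair
  split_ifs with hx
  · by_contra! h'
    obtain ⟨y, hy, hyx⟩ := exists_mem_ne h'.2 x
    obtain ⟨i, hi⟩ := h.sameCycle x h'.1 y hy
    rw [Perm.zpow_apply_eq_self_of_apply_eq_self hx.symm] at hi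
    exact hyx hi.symm
  · have hxA : x ∈ A := by
      by_contra h'
      exact hx (h.fixes x h').symm
    exact ⟨hxA, apply_mem_of_fixes h.fixes hxA⟩

theorem fixes_of_coverPair {σ : Perm (Fin n)} {A : Finset (Fin n)}
    (h : ∀ x, CoverPair A x (σ x)) : ∀ x ∉ A, σ x = x := by
  intro x hx
  by_contra h'
  have := h x
  rw [CoverPair, if_neg (Ne.symm h')] at this
  exact hx this.1

theorem two_mul_card_cycleMinima_le_of_coverPair {σ : Perm (Fin n)} {A : Finset (Fin n)}
    (h : ∀ x, CoverPair A x (σ x)) : 2 * #(cycleMinima σ A) ≤ #A + 1 := by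
  rcases le_or_gt #A 1 with hA | hA
  · have := card_le_card (cycleMinima_subset σ A)
    lia
  · refine (two_mul_card_cycleMinima_le (fixes_of_coverPair h) fun x hx e => ?_).trans
      (Nat.le_succ _)
    have := h x
    rw [CoverPair, if_pos e.symm] at this
    exact this.elim (fun h' => h' hx) (fun h' => absurd h' hA.not_ge)

/-- A minimum-weight cycle cover of a set of vertices weighs at most as much as a tour. -/
theorem permCost_le_opt_of_dualCertificate (I : SemiMetricTSP) {A : Finset (Fin I.n)}
    {u v : Fin I.n → ℝ} {σ : Perm (Fin I.n)}
    (h : DualCertificate I.w (CoverPair A) u v σ) : permCost I.w A σ ≤ I.opt := by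
  obtain ⟨ρ, hρ, hc⟩ := I.exists_cyclicOn_permCost_le_opt A
  refine le_trans ?_ hc
  have h₁ := h.sum_le hρ.coverPair
  have hloop : ∑ x ∈ Aᶜ, I.w x (σ x) = ∑ x ∈ Aᶜ, I.w x (ρ x) := sum_congr rfl fun x hx => by
    rw [mem_compl] at hx
    rw [fixes_of_coverPair h.admissible x hx, hρ.fixes x hx]
  rw [← sum_add_sum_compl A, ← sum_add_sum_compl A (fun x => I.w x (ρ x)), hloop] at h₁
  exact le_of_add_le_add_right h₁

end CycleCover

/-! ### Filling a row of an array -/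

namespace SProg

/-- Assign the value of `e` to the scalar variable `v`. -/
abbrev assign (v : ℕ) (e : NExp) : SProg := setNat v (.const 0) (.const 0) (.const 0) e

/-- For all `x < n`, with the counter `c` equal to `x`, write `e` to the cell `[i, x, 0]` of the
array `v`. -/
def fillNat (c v : ℕ) (i e : NExp) : SProg := forLt c (setNat v i (.sc c) (.const 0) e)

/-- For all `x < n`, with the counter `c` equal to `x`, write `e` to the cell `[0, i, x]` of the
array `v`. -/
def fillReal (c v : ℕ) (i : NExp) (e : RExp) : SProg := forLt c (setReal v (.const 0) i (.sc c) e)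

theorem run_fillNat {n c v a : ℕ} {i e : NExp} {s : Store} (hn : s.nat 0 0 0 0 = n) (hvc : v ≠ c)
    (f : ℕ → ℕ)
    (he : ∀ k < n, ∀ s' : Store, s'.nat c 0 0 0 = k → (∀ v', v' ≠ c → v' ≠ v → s'.nat v' = s.nat v') →
      s'.real = s.real → (∀ i', i' ≠ a → s'.nat v i' = s.nat v i') →
      (∀ x, k ≤ x → s'.nat v a x 0 = s.nat v a x 0) → i.eval s' = a ∧ e.eval s' = f k) :
    (∀ x < n, ((fillNat c v i e).run s).nat v a x 0 = f x) ∧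
      ∀ i', i' ≠ a → ((fillNat c v i e).run s).nat v i' = s.nat v i' := by
  have := run_forLt (c := c) (p := setNat v i (.sc c) (.const 0) e) hn
    (fun k s' => (∀ x < k, s'.nat v a x 0 = f x) ∧ (∀ i', i' ≠ a → s'.nat v i' = s.nat v i') ∧
      ∀ x, k ≤ x → s'.nat v a x 0 = s.nat v a x 0)
    ⟨by simp, fun i' _ => by rw [s.setNat_nat_of_ne _ _ _ _ hvc],
      fun x _ => by rw [s.setNat_nat_of_ne _ _ _ _ hvc]⟩ ?_
  · exact ⟨this.1, this.2.1⟩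
  · rintro k hk s' hs' hc ⟨h₁, h₂, h₃⟩
    obtain ⟨hi, hev⟩ := he k hk s' hc (fun v' h h' => hs'.nat v' (by simp [natWrites, h, h']))
      (funext fun v' => hs'.real v' (by simp [realWrites])) h₂ h₃
    have hrun : ∀ i' x l, (((setNat v i (.sc c) (.const 0) e).run s').setNat c 0 0 0 (k + 1)).nat
        v i' x l = if i' = a ∧ x = k ∧ l = 0 then f k else s'.nat v i' x l := by
      intro i' x l
      simp [run, NExp.eval, hi, hev, hc, hvc]
    refine ⟨fun x hx => ?_, fun i' hi' => ?_, fun x hx => ?_⟩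
    · rw [hrun]
      split_ifs with h
      · rw [h.2.1]
      · exact h₁ x (by lia)
    · funext x l
      rw [hrun, if_neg (fun h => hi' h.1), h₂ i' hi']
    · rw [hrun, if_neg (by lia)]
      exact h₃ x (by lia)

theorem run_fillReal {n c v a : ℕ} {i : NExp} {e : RExp} {s : Store} (hn : s.nat 0 0 0 0 = n)
    (f : ℕ → ℝ)
    (he : ∀ k < n, ∀ s' : Store, s'.nat c 0 0 0 = k → (∀ v', v' ≠ c → s'.nat v' = s.nat v') →
      (∀ v', v' ≠ v → s'.real v' = s.real v') → i.eval s' = a ∧ e.eval s' = f k) :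
    (∀ x < n, ((fillReal c v i e).run s).real v 0 a x = f x) ∧
      ∀ i', i' ≠ a → ∀ x, ((fillReal c v i e).run s).real v 0 i' x = s.real v 0 i' x := by
  have := run_forLt (c := c) (p := setReal v (.const 0) i (.sc c) e) hn
    (fun k s' => (∀ x < k, s'.real v 0 a x = f x) ∧
      ∀ i', i' ≠ a → ∀ x, s'.real v 0 i' x = s.real v 0 i' x)
    ⟨by simp, fun i' _ x => rfl⟩ ?_
  · exact this
  · rintro k hk s' hs' hc ⟨h₁, h₂⟩
    obtain ⟨hi, hev⟩ := he k hk s' hc (fun v' h => hs'.nat v' (by simp [natWrites, h]))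
      (fun v' h => hs'.real v' (by simp [realWrites, h]))
    have hrun : ∀ i' x, (((setReal v (.const 0) i (.sc c) e).run s').setNat c 0 0 0 (k + 1)).real
        v 0 i' x = if i' = a ∧ x = k then f k else s'.real v 0 i' x := by
      intro i' x
      simp [run, NExp.eval, hi, hev, hc]
    refine ⟨fun x hx => ?_, fun i' hi' x => ?_⟩
    · rw [hrun]
      split_ifs with h
      · rw [h.2]
      · exact h₁ x (by lia)
    · rw [hrun, if_neg (fun h => hi' h.1), h₂ i' hi']

end SProg

/-! ### The assignment algorithm as a program -/

/- The arrays of natural numbers: the indicator of the vertices that are left, the assignment, the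
shifted assignments of the rows of the tree, the indicator of the rows of the tree, the indicator of
the admissible pairs, the composition of the cycle covers of all rounds, a list of the vertices that
are left, and the tour by successors. -/
local notation "ALIVE" => (5 : ℕ)
local notation "COVER" => (6 : ℕ)
local notation "SHIFTED" => (7 : ℕ)
local notation "TREE" => (8 : ℕ)
local notation "PAIR" => (9 : ℕ)
local notation "PATH" => (19 : ℕ)
local notation "REP" => (11 : ℕ)
local notation "SUCC" => (18 : ℕ)
/- The scalar variables: the number of vertices that are left, the pair of smallest slack, auxiliary
variables, and the counters of the loops. -/
local notation "COUNT" => (10 : ℕ)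
local notation "FOUND" => (12 : ℕ)
local notation "ROW" => (13 : ℕ)
local notation "COL" => (14 : ℕ)
local notation "DONE" => (15 : ℕ)
local notation "CUR" => (16 : ℕ)
local notation "FLAG" => (17 : ℕ)
local notation "PHASE" => (20 : ℕ)
local notation "STEP" => (21 : ℕ)
local notation "CA" => (22 : ℕ)
local notation "CB" => (23 : ℕ)
/- The arrays of real numbers: the input, the output, the costs of the assignment problem, the
potentials of the rows and of the columns, and the smallest slack. -/
local notation "WEIGHT" => (0 : ℕ)
local notation "OUTPUT" => (1 : ℕ)
local notation "COST" => (2 : ℕ)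
local notation "ROWPOT" => (3 : ℕ)
local notation "COLPOT" => (4 : ℕ)
local notation "SLACK" => (5 : ℕ)

namespace SProg

/-- The entry `x` of a one-dimensional array. -/
abbrev entry (v : ℕ) (x : NExp) : NExp := .get v (.const 0) x (.const 0)

/-- The slack of the pair `(CA, σ CB)`. -/
def slackExp : RExp :=
  .sub (.sub (.get COST (.const 0) (.sc CA) (entry COVER (.sc CB)))
    (.get ROWPOT (.const 0) (.const 0) (.sc CA)))
    (.get COLPOT (.const 0) (.const 0) (entry COVER (.sc CB)))

/-- The pair `(CA, σ CB)` is admissible and leaves the tree. -/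
def leavesExp : BExp :=
  .and (.natLe (.const 1) (entry TREE (.sc CA)))
    (.and (.not (.and (.natLe (.const 1) (entry TREE (.sc CB))) (.not (.natEq (.sc CB) (.sc PHASE)))))
      (.natLe (.const 1) (.get PAIR (.sc CA) (entry COVER (.sc CB)) (.const 0))))

/-- Compare the pair `(CA, σ CB)` with the best pair found so far. -/
def scanPair : SProg :=
  branch leavesExp
    (branch (.and (.natLe (.const 1) (.sc FOUND))
        (.realLe (.get SLACK (.const 0) (.const 0) (.const 0)) slackExp))
      skip
      (seq (assign FOUND (.const 1)) (seq (assign ROW (.sc CA)) (seq (assign COL (.sc CB))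
        (setReal SLACK (.const 0) (.const 0) (.const 0) slackExp)))))
    skip

/-- Find the pair of smallest slack among those that leave the tree. -/
def scan : SProg := seq (assign FOUND (.const 0)) (forLt CA (forLt CB scanPair))

/-- Change the potentials of the row `CA` and of its column by the smallest slack, if they belong to
the tree. -/
def updatePair : SProg :=
  branch (.natLe (.const 1) (entry TREE (.sc CA)))
    (seq (setReal ROWPOT (.const 0) (.const 0) (.sc CA)
        (.add (.get ROWPOT (.const 0) (.const 0) (.sc CA))
          (.get SLACK (.const 0) (.const 0) (.const 0))))
      (branch (.natEq (.sc CA) (.sc PHASE)) skip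
        (setReal COLPOT (.const 0) (.const 0) (entry COVER (.sc CA))
          (.sub (.get COLPOT (.const 0) (.const 0) (entry COVER (.sc CA)))
            (.get SLACK (.const 0) (.const 0) (.const 0))))))
    skip

/-- Change the potentials of the rows and columns of the tree by the smallest slack. -/
def updatePotentials : SProg := forLt CA updatePair

/-- Replace the assignment by a shifted one. -/
def finishTree : SProg :=
  seq (assign DONE (.const 1))
    (fillNat CA COVER (.const 0) (.get SHIFTED (.sc ROW) (.sc CA) (.const 0)))

/-- Add a row to the tree, with its shifted assignment. -/
def extendTree : SProg :=
  seq (fillNat CA SHIFTED (.sc COL) (.get SHIFTED (.sc ROW) (.sc CA) (.const 0)))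
    (seq (setNat SHIFTED (.sc COL) (.sc ROW) (.const 0)
        (.get SHIFTED (.sc ROW) (.sc COL) (.const 0)))
      (seq (setNat SHIFTED (.sc COL) (.sc COL) (.const 0)
          (.get SHIFTED (.sc ROW) (.sc ROW) (.const 0)))
        (setNat TREE (.const 0) (.sc COL) (.const 0) (.const 1))))

/-- One step of the search for an augmenting path. -/
def treeStep : SProg :=
  seq scan (seq updatePotentials (branch (.natEq (.sc COL) (.sc PHASE)) finishTree extendTree))

variable {n : ℕ} {c : Fin n → Fin n → ℝ} {E : Fin n → Fin n → Prop}
  {σ : Perm (Fin n)} {u v : Fin n → ℝ} {m : Fin n} {T : Finset (Fin n)} {M : Fin n → Perm (Fin n)}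

/-- The memory holds an assignment problem, an assignment and potentials. -/
structure HoldsAssignment (c : Fin n → Fin n → ℝ) (E : Fin n → Fin n → Prop) (u v : Fin n → ℝ)
    (σ : Perm (Fin n)) (s : Store) : Prop where
  size : s.nat 0 0 0 0 = n
  cost : ∀ x y : Fin n, s.real COST 0 x y = c x y
  pair : ∀ x y : Fin n, 1 ≤ s.nat PAIR x y 0 ↔ E x y
  cover : ∀ x : Fin n, s.nat COVER 0 x 0 = σ x
  rowpot : ∀ x : Fin n, s.real ROWPOT 0 0 x = u x
  colpot : ∀ x : Fin n, s.real COLPOT 0 0 x = v x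

/-- The memory holds an alternating tree for the row `m`. -/
structure HoldsTree (m : Fin n) (T : Finset (Fin n)) (M : Fin n → Perm (Fin n)) (s : Store) :
    Prop where
  phase : s.nat PHASE 0 0 0 = m
  tree : ∀ x : Fin n, 1 ≤ s.nat TREE 0 x 0 ↔ x ∈ T
  shifted : ∀ i ∈ T, ∀ x : Fin n, s.nat SHIFTED i x 0 = M i x

theorem HoldsAssignment.congr {s s' : Store} (h : HoldsAssignment c E u v σ s)
    (h₀ : s'.nat 0 = s.nat 0) (h₁ : s'.nat PAIR = s.nat PAIR) (h₂ : s'.nat COVER = s.nat COVER)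
    (h₃ : s'.real COST = s.real COST) (h₄ : s'.real ROWPOT = s.real ROWPOT)
    (h₅ : s'.real COLPOT = s.real COLPOT) : HoldsAssignment c E u v σ s' := by
  constructor
  · rw [h₀, h.size]
  · rw [h₃]; exact h.cost
  · rw [h₁]; exact h.pair
  · rw [h₂]; exact h.cover
  · rw [h₄]; exact h.rowpot
  · rw [h₅]; exact h.colpot

theorem HoldsTree.congr {s s' : Store} (h : HoldsTree m T M s)
    (h₀ : s'.nat PHASE = s.nat PHASE) (h₁ : s'.nat TREE = s.nat TREE)
    (h₂ : s'.nat SHIFTED = s.nat SHIFTED) : HoldsTree m T M s' := by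
  constructor
  · rw [h₀, h.phase]
  · rw [h₁]; exact h.tree
  · rw [h₂]; exact h.shifted

/-- The variables hold the pair of smallest slack among the pairs `(i, σ l)` that leave the tree and
satisfy `P i l`, if there is one. -/
def ScanInv (c : Fin n → Fin n → ℝ) (E : Fin n → Fin n → Prop) (u v : Fin n → ℝ)
    (σ : Perm (Fin n)) (m : Fin n) (T : Finset (Fin n)) (P : Fin n → Fin n → Prop) (s : Store) :
    Prop :=
  (s.nat FOUND 0 0 0 = 0 ∧ ∀ i l, LeavesTree E σ m T i l → ¬ P i l) ∨
    (1 ≤ s.nat FOUND 0 0 0 ∧ ∃ i₀ l₀ : Fin n, LeavesTree E σ m T i₀ l₀ ∧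
      (∀ i l, LeavesTree E σ m T i l → P i l →
        c i₀ (σ l₀) - u i₀ - v (σ l₀) ≤ c i (σ l) - u i - v (σ l)) ∧
      s.nat ROW 0 0 0 = i₀ ∧ s.nat COL 0 0 0 = l₀ ∧
      s.real SLACK 0 0 0 = c i₀ (σ l₀) - u i₀ - v (σ l₀))

theorem run_scanPair {s : Store} (hs : HoldsAssignment c E u v σ s) (ht : HoldsTree m T M s)
    {i l : Fin n} (hi : s.nat CA 0 0 0 = i) (hl : s.nat CB 0 0 0 = l) {P P' : Fin n → Fin n → Prop}
    (hP : ∀ i' l', P' i' l' ↔ P i' l' ∨ i' = i ∧ l' = l) (h : ScanInv c E u v σ m T P s) :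
    ScanInv c E u v σ m T P' (scanPair.run s) := by
  have hslack : slackExp.eval s = c i (σ l) - u i - v (σ l) := by
    simp [slackExp, RExp.eval, NExp.eval, hi, hl, hs.cover, hs.cost, hs.rowpot, hs.colpot]
  have hleaves : leavesExp.Holds s ↔ LeavesTree E σ m T i l := by
    simp only [leavesExp, BExp.Holds, NExp.eval, hi, hl, hs.cover, ht.phase, LeavesTree, ht.tree,
      hs.pair, Fin.ext_iff]
    have : ((l : ℕ) ≤ m ∧ (m : ℕ) ≤ l) ↔ (l : ℕ) = m := by lia
    rw [this]
    tauto
  unfold scanPair run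
  rw [hleaves]
  split_ifs with h₁
  · unfold run
    rcases h with ⟨hf, hno⟩ | ⟨hf, i₀, l₀, h₀, hmin, hrow, hcol, hsl⟩
    · rw [if_neg (by simp [BExp.Holds, NExp.eval, hf])]
      refine .inr ⟨by simp [run, NExp.eval], i, l, h₁, ?_, by simp [run, NExp.eval, hi],
        by simp [run, NExp.eval, hl], ?_⟩
      · intro i' l' h' hP'
        obtain h'' | ⟨rfl, rfl⟩ := (hP i' l').1 hP'
        · exact absurd h'' (hno i' l' h')
        · exact le_rfl
      · rw [← hslack]
        simp [run, slackExp, RExp.eval, NExp.eval]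
    · split_ifs with h₂
      · refine .inr ⟨hf, i₀, l₀, h₀, ?_, hrow, hcol, hsl⟩
        simp only [BExp.Holds, hslack, RExp.eval, NExp.eval, hsl] at h₂
        intro i' l' h' hP'
        obtain h'' | ⟨rfl, rfl⟩ := (hP i' l').1 hP'
        · exact hmin i' l' h' h''
        · exact h₂.2
      · refine .inr ⟨by simp [run, NExp.eval], i, l, h₁, ?_, by simp [run, NExp.eval, hi],
          by simp [run, NExp.eval, hl], ?_⟩
        · simp only [BExp.Holds, hslack, RExp.eval, NExp.eval, hsl, not_and, not_le] at h₂
          intro i' l' h' hP'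
          obtain h'' | ⟨rfl, rfl⟩ := (hP i' l').1 hP'
          · exact (h₂ hf).le.trans (hmin i' l' h' h'')
          · exact le_rfl
        · rw [← hslack]
          simp [run, slackExp, RExp.eval, NExp.eval]
  · unfold run
    rcases h with ⟨hf, hno⟩ | ⟨hf, i₀, l₀, h₀, hmin, hrest⟩
    · refine .inl ⟨hf, fun i' l' h' hP' => ?_⟩
      obtain h'' | ⟨rfl, rfl⟩ := (hP i' l').1 hP'
      · exact hno i' l' h' h''
      · exact h₁ h'
    · refine .inr ⟨hf, i₀, l₀, h₀, fun i' l' h' hP' => ?_, hrest⟩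
      obtain h'' | ⟨rfl, rfl⟩ := (hP i' l').1 hP'
      · exact hmin i' l' h' h''
      · exact absurd h' h₁

theorem ScanInv.congr {P : Fin n → Fin n → Prop} {s s' : Store} (h : ScanInv c E u v σ m T P s)
    (h₁ : s'.nat FOUND = s.nat FOUND) (h₂ : s'.nat ROW = s.nat ROW) (h₃ : s'.nat COL = s.nat COL)
    (h₄ : s'.real SLACK = s.real SLACK) : ScanInv c E u v σ m T P s' := by
  unfold ScanInv
  rw [h₁, h₂, h₃, h₄]
  exact h

theorem run_scan {s : Store} (hs : HoldsAssignment c E u v σ s) (ht : HoldsTree m T M s)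
    (hex : ∃ i l, LeavesTree E σ m T i l) :
    ∃ i₀ l₀ : Fin n, LeavesTree E σ m T i₀ l₀ ∧
      (∀ i l, LeavesTree E σ m T i l →
        c i₀ (σ l₀) - u i₀ - v (σ l₀) ≤ c i (σ l) - u i - v (σ l)) ∧
      (scan.run s).nat ROW 0 0 0 = i₀ ∧ (scan.run s).nat COL 0 0 0 = l₀ ∧
      (scan.run s).real SLACK 0 0 0 = c i₀ (σ l₀) - u i₀ - v (σ l₀) := by
  have hinv : ScanInv c E u v σ m T (fun i _ => (i : ℕ) < n) (scan.run s) := by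
    unfold scan
    rw [run]
    refine run_forLt (n := n) (by simp [run, NExp.eval, hs.size])
      (fun k => ScanInv c E u v σ m T fun i _ => (i : ℕ) < k) ?_ ?_
    · exact .inl ⟨by simp [run, NExp.eval], by simp⟩
    · intro k hk s₁ hs₁ hk₁ h₁
      suffices ScanInv c E u v σ m T (fun i l => (i : ℕ) < k ∨ (i : ℕ) = k ∧ (l : ℕ) < n)
          ((forLt CB scanPair).run s₁) by
        refine (?_ : ScanInv c E u v σ m T _ ((forLt CB scanPair).run s₁)).congr
          ?_ ?_ ?_ rfl <;> try exact Store.setNat_nat_of_ne _ _ _ _ _ (by decide)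
        convert this using 3 with i l
        have := l.2
        lia
      have hfr : ∀ v ∉ scan.natWrites, s₁.nat v = s.nat v := fun v hv => by
        rw [hs₁.nat v (fun h => hv (List.mem_append_right _ h))]
        exact run_nat_of_notMem _ _ (fun h => hv (List.mem_append_left _ h))
      have hfr' : ∀ v ∉ scan.realWrites, s₁.real v = s.real v := fun v hv => by
        rw [hs₁.real v (fun h => hv (List.mem_append_right _ h))]
        exact run_real_of_notMem _ _ (fun h => hv (List.mem_append_left _ h))
      refine run_forLt (n := n) (by rw [hfr 0 (by decide), hs.size])
        (fun k' => ScanInv c E u v σ m T fun i l => (i : ℕ) < k ∨ (i : ℕ) = k ∧ (l : ℕ) < k') ?_ ?_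
      · refine ScanInv.congr (s := s₁) (by simpa using h₁) ?_ ?_ ?_ rfl <;>
          exact Store.setNat_nat_of_ne _ _ _ _ _ (by decide)
      · intro k' hk' s₂ hs₂ hk₂ h₂
        have hfr₂ : ∀ v ∉ scan.natWrites, s₂.nat v = s.nat v := fun v hv => by
          rw [hs₂.nat v (fun h => hv (List.mem_append_right _ (List.mem_cons_of_mem _ h))), hfr v hv]
        have hfr₂' : ∀ v ∉ scan.realWrites, s₂.real v = s.real v := fun v hv => by
          rw [hs₂.real v (fun h => hv (List.mem_append_right _ h)), hfr' v hv]
        refine ScanInv.congr (s := scanPair.run s₂) (run_scanPair (i := ⟨k, hk⟩) (l := ⟨k', hk'⟩)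
          (hs.congr ?_ ?_ ?_ ?_ ?_ ?_) (ht.congr ?_ ?_ ?_) ?_ hk₂ ?_ h₂) ?_ ?_ ?_ rfl
        any_goals exact Store.setNat_nat_of_ne _ _ _ _ _ (by decide)
        any_goals exact hfr₂ _ (by decide)
        any_goals exact hfr₂' _ (by decide)
        · rw [hs₂.nat CA (by decide), hk₁]
        · intro i' l'
          simp only [Fin.ext_iff]
          lia
  rcases hinv with ⟨-, hno⟩ | ⟨-, i₀, l₀, h₀, hmin, hrest⟩
  · obtain ⟨i, l, h⟩ := hex
    exact absurd i.2 (hno i l h)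
  · exact ⟨i₀, l₀, h₀, fun i l h => hmin i l h i.2, hrest⟩

end SProg

namespace SProg

variable {n : ℕ} {c : Fin n → Fin n → ℝ} {E : Fin n → Fin n → Prop}
  {σ : Perm (Fin n)} {u v : Fin n → ℝ} {m : Fin n} {T : Finset (Fin n)} {M : Fin n → Perm (Fin n)}

theorem run_updatePotentials {s : Store} (hs : HoldsAssignment c E u v σ s)
    (ht : HoldsTree m T M s) {δ : ℝ} (hδ : s.real SLACK 0 0 0 = δ) :
    HoldsAssignment c E (fun x => if x ∈ T then u x + δ else u x)
      (fun y => if σ.symm y ∈ T ∧ σ.symm y ≠ m then v y - δ else v y) σ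
      (updatePotentials.run s) := by
  have hfr : ∀ v ∉ updatePotentials.natWrites, (updatePotentials.run s).nat v = s.nat v :=
    fun _ hv => run_nat_of_notMem _ _ hv
  have hpot := run_forLt (n := n) (s := s) (c := CA) (p := updatePair) hs.size
    (fun k s' => (∀ x : Fin n, s'.real ROWPOT 0 0 x = if (x : ℕ) < k ∧ x ∈ T then u x + δ else u x) ∧
      ∀ x : Fin n, s'.real COLPOT 0 0 (σ x) =
        if (x : ℕ) < k ∧ x ∈ T ∧ x ≠ m then v (σ x) - δ else v (σ x))
    (by simp [hs.rowpot, hs.colpot]) ?_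
  · obtain ⟨h₁, h₂⟩ := hpot
    refine ⟨?_, ?_, ?_, ?_, fun x => ?_, fun y => ?_⟩
    · rw [hfr _ (by decide), hs.size]
    · rw [run_real_of_notMem _ _ (by decide)]
      exact hs.cost
    · rw [hfr _ (by decide)]
      exact hs.pair
    · rw [hfr _ (by decide)]
      exact hs.cover
    · have := h₁ x
      simpa [updatePotentials] using this
    · have := h₂ (σ.symm y)
      simpa [updatePotentials] using this
  · rintro k hk s' hs' hc ⟨h₁, h₂⟩
    obtain ⟨x₀, rfl⟩ : ∃ x₀ : Fin n, (x₀ : ℕ) = k := ⟨⟨k, hk⟩, rfl⟩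
    have hcov := hs.cover x₀
    have hT := ht.tree x₀
    have hph := ht.phase
    rw [← hs'.nat _ (by decide)] at hcov hT hph
    rw [← hs'.real _ (by decide)] at hδ
    have hval : ∀ x y : Fin n, (x : ℕ) = y ↔ x = y := fun x y => Fin.ext_iff.symm
    have hm : (x₀ ≤ m ∧ m ≤ x₀) ↔ x₀ = m := le_antisymm_iff.symm
    have hrow : ∀ x : Fin n, (updatePair.run s').real ROWPOT 0 0 x =
        if x = x₀ ∧ x₀ ∈ T then s'.real ROWPOT 0 0 x + δ else s'.real ROWPOT 0 0 x := by
      intro x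
      by_cases hTx : x₀ ∈ T <;> by_cases hmx : x₀ = m <;> by_cases hx : x = x₀ <;>
        simp [updatePair, run, BExp.Holds, RExp.eval, NExp.eval, hc, hT, hTx, hph, hm, hmx, hδ, hval,
          hx] <;> simp_all
    have hcol : ∀ x : Fin n, (updatePair.run s').real COLPOT 0 0 (σ x) =
        if x = x₀ ∧ x₀ ∈ T ∧ x₀ ≠ m then s'.real COLPOT 0 0 (σ x) - δ
        else s'.real COLPOT 0 0 (σ x) := by
      intro x
      by_cases hTx : x₀ ∈ T <;> by_cases hmx : x₀ = m <;> by_cases hx : x = x₀ <;>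
        simp [updatePair, run, BExp.Holds, RExp.eval, NExp.eval, hc, hT, hTx, hph, hm, hmx, hδ, hval,
          hx, hcov] <;> simp_all
    have hlt : ∀ x : Fin n, x ≠ x₀ → ((x : ℕ) < x₀ + 1 ↔ (x : ℕ) < x₀) := fun x hx => by
      have := Fin.val_ne_of_ne hx
      lia
    refine ⟨fun x => ?_, fun x => ?_⟩
    · rw [Store.setNat_real, hrow, h₁]
      by_cases hx : x = x₀
      · simp [hx]
      · simp [hx, hlt x hx]
    · rw [Store.setNat_real, hcol, h₂]
      by_cases hx : x = x₀
      · simp [hx]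
      · simp [hx, hlt x hx]

theorem run_finishTree {s : Store} (hs : HoldsAssignment c E u v σ s) (ht : HoldsTree m T M s)
    {i₀ : Fin n} (hi₀ : i₀ ∈ T) (hrow : s.nat ROW 0 0 0 = i₀) :
    HoldsAssignment c E u v (M i₀) (finishTree.run s) := by
  have hfill := run_fillNat (n := n) (c := CA) (v := COVER) (a := 0) (i := .const 0)
    (e := .get SHIFTED (.sc ROW) (.sc CA) (.const 0)) (s := (assign DONE (.const 1)).run s)
    (by simp [run, NExp.eval, hs.size]) (by decide) (fun x => s.nat SHIFTED i₀ x 0) ?_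
  · refine ⟨?_, ?_, ?_, fun x => ?_, ?_, ?_⟩
    · rw [run_nat_of_notMem _ _ (by decide), hs.size]
    · rw [run_real_of_notMem _ _ (by decide)]
      exact hs.cost
    · rw [run_nat_of_notMem _ _ (by decide)]
      exact hs.pair
    · rw [← ht.shifted i₀ hi₀ x]
      exact hfill.1 x x.2
    · rw [run_real_of_notMem _ _ (by decide)]
      exact hs.rowpot
    · rw [run_real_of_notMem _ _ (by decide)]
      exact hs.colpot
  · intro k hk s' hc hs' _ _ _
    simp only [NExp.eval, hc, hs' SHIFTED (by decide) (by decide), hs' ROW (by decide) (by decide)]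
    simp [run, NExp.eval, hrow]

theorem run_extendTree {s : Store} (hn : s.nat 0 0 0 0 = n) (ht : HoldsTree m T M s)
    {i₀ l₀ : Fin n} (hi₀ : i₀ ∈ T) (hl₀ : l₀ ∉ T) (hrow : s.nat ROW 0 0 0 = i₀)
    (hcol : s.nat COL 0 0 0 = l₀) :
    HoldsTree m (insert l₀ T) (Function.update M l₀ (M i₀ * swap i₀ l₀)) (extendTree.run s) := by
  have hne : i₀ ≠ l₀ := fun e => hl₀ (e ▸ hi₀)
  have hne' : (i₀ : ℕ) ≠ l₀ := fun e => hne (Fin.ext e)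
  have hfill := run_fillNat (n := n) (c := CA) (v := SHIFTED) (a := l₀) (i := .sc COL)
    (e := .get SHIFTED (.sc ROW) (.sc CA) (.const 0)) (s := s) hn (by decide)
    (fun x => s.nat SHIFTED i₀ x 0) ?_
  · have hfr : ∀ v ∉ [CA, SHIFTED], ((fillNat CA SHIFTED (.sc COL)
        (.get SHIFTED (.sc ROW) (.sc CA) (.const 0))).run s).nat v = s.nat v :=
      fun v hv => run_nat_of_notMem _ _ hv
    unfold extendTree
    rw [run]
    revert hfill hfr
    generalize (fillNat CA SHIFTED (.sc COL) (.get SHIFTED (.sc ROW) (.sc CA) (.const 0))).run s = s₁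
    rintro ⟨hnew, hold⟩ hfr
    have hrow₁ : s₁.nat ROW 0 0 0 = i₀ := by rw [hfr _ (by decide), hrow]
    have hcol₁ : s₁.nat COL 0 0 0 = l₀ := by rw [hfr _ (by decide), hcol]
    have hval : ∀ x y : Fin n, ((x : ℕ) = y) ↔ x = y := fun x y => Fin.ext_iff.symm
    have hi₀x : ∀ x : Fin n, s₁.nat SHIFTED i₀ x 0 = M i₀ x := fun x => by
      rw [hold i₀ hne', ht.shifted i₀ hi₀]
    have hl₀x : ∀ x : Fin n, s₁.nat SHIFTED l₀ x 0 = M i₀ x := fun x => by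
      rw [hnew x x.2, ht.shifted i₀ hi₀]
    refine ⟨?_, fun x => ?_, fun i hi x => ?_⟩
    · simp [run, hfr, ht.phase]
    · have := ht.tree x
      by_cases hx : x = l₀
      · simp [run, NExp.eval, hcol₁, hx]
      · simp [run, NExp.eval, hcol₁, hx, hval, hfr, this]
    · by_cases hil : i = l₀
      · subst hil
        by_cases hx₁ : x = i
        · subst hx₁
          simp [run, NExp.eval, hcol₁, hrow₁, hval, hne, hi₀x]
        · by_cases hx₂ : x = i₀
          · subst hx₂
            simp [run, NExp.eval, hcol₁, hrow₁, hval, hne, hi₀x]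
          · simp [run, NExp.eval, hcol₁, hrow₁, hval, hx₁, hx₂, hl₀x, swap_apply_of_ne_of_ne]
      · have hiT : i ∈ T := (mem_insert.1 hi).resolve_left hil
        have hil' : (i : ℕ) ≠ l₀ := fun e => hil (Fin.ext e)
        simp [run, NExp.eval, hcol₁, hrow₁, hil', hil, hold, ht.shifted i hiT]
  · intro k hk s' hc hs' _ hrows _
    simp only [NExp.eval, hc, hs' ROW (by decide) (by decide), hs' COL (by decide) (by decide), hrow,
      hcol, hrows i₀ hne', and_self]

/-- One step of the search either completes the assignment or adds a row to the tree. -/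
theorem run_treeStep {s : Store} (hs : HoldsAssignment c E u v σ s) (ht : HoldsTree m T M s)
    (hdone : s.nat DONE 0 0 0 = 0) (h : AlternatingTree c E σ m u v T M) {ρ : Perm (Fin n)}
    (hρ : ∀ x, E x (ρ x)) :
    ∃ u' v', (1 ≤ (treeStep.run s).nat DONE 0 0 0 ∧ ∃ σ', DualCertificate c E u' v' σ' ∧
        HoldsAssignment c E u' v' σ' (treeStep.run s)) ∨
      ((treeStep.run s).nat DONE 0 0 0 = 0 ∧ ∃ T' M', #T' = #T + 1 ∧
        AlternatingTree c E σ m u' v' T' M' ∧ HoldsAssignment c E u' v' σ (treeStep.run s) ∧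
        HoldsTree m T' M' (treeStep.run s)) := by
  obtain ⟨i₀, l₀, h₀, hmin, hrow, hcol, hsl⟩ := run_scan hs ht (exists_leavesTree h.root_mem hρ)
  have hs₁ : HoldsAssignment c E u v σ (scan.run s) := by
    apply hs.congr
    any_goals exact run_nat_of_notMem _ _ (by decide)
    any_goals exact run_real_of_notMem _ _ (by decide)
  have ht₁ : HoldsTree m T M (scan.run s) := by
    apply ht.congr <;> exact run_nat_of_notMem _ _ (by decide)
  have hs₂ := run_updatePotentials hs₁ ht₁ hsl
  have ht₂ : HoldsTree m T M (updatePotentials.run (scan.run s)) := by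
    apply ht₁.congr <;> exact run_nat_of_notMem _ _ (by decide)
  have hdone₂ : (updatePotentials.run (scan.run s)).nat DONE 0 0 0 = 0 := by
    rw [run_nat_of_notMem _ _ (by decide), run_nat_of_notMem _ _ (by decide), hdone]
  rw [← run_nat_of_notMem updatePotentials (scan.run s) (by decide)] at hrow hcol
  unfold treeStep
  rw [run, run]
  revert hs₂ ht₂ hdone₂ hrow hcol
  generalize updatePotentials.run (scan.run s) = s₂
  intro hrow hcol hs₂ ht₂ hdone₂
  refine ⟨fun x => if x ∈ T then u x + (c i₀ (σ l₀) - u i₀ - v (σ l₀)) else u x,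
    fun y => if σ.symm y ∈ T ∧ σ.symm y ≠ m then v y - (c i₀ (σ l₀) - u i₀ - v (σ l₀)) else v y, ?_⟩
  have hm : ((l₀ : ℕ) ≤ m ∧ (m : ℕ) ≤ l₀) ↔ l₀ = m := by
    rw [Fin.ext_iff]
    lia
  by_cases hl₀ : l₀ = m
  · rw [run, if_pos (by simpa only [BExp.Holds, NExp.eval, hcol, ht₂.phase, hm] using hl₀)]
    refine .inl ⟨?_, M i₀, h.dualCertificate h₀ hmin (fun x => rfl) (fun l => ?_) hl₀,
      run_finishTree hs₂ ht₂ h₀.1 hrow⟩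
    · rw [finishTree, run, run_nat_of_notMem _ _ (by decide)]
      simp [run, NExp.eval]
    · simp
  · have hlT := h₀.2.1.resolve_right hl₀
    rw [run, if_neg (by simpa only [BExp.Holds, NExp.eval, hcol, ht₂.phase, hm] using hl₀)]
    refine .inr ⟨?_, _, _, card_insert_of_notMem hlT,
      h.insert h₀ hmin (fun x => rfl) (fun l => ?_) hl₀, ?_,
      run_extendTree hs₂.size ht₂ h₀.1 hlT hrow hcol⟩
    · rw [run_nat_of_notMem _ _ (by decide), hdone₂]
    · simp
    · apply hs₂.congr
      any_goals exact run_nat_of_notMem _ _ (by decide)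
      any_goals exact run_real_of_notMem _ _ (by decide)

end SProg

/-! ### The phases of the assignment algorithm -/

namespace SProg

/-- Extend the tree until it reaches the free column, which happens within `n` steps. -/
def growTree : SProg := forLt STEP (branch (.natLe (.const 1) (.sc DONE)) skip treeStep)

theorem run_growTree {n : ℕ} {c : Fin n → Fin n → ℝ} {E : Fin n → Fin n → Prop}
    {σ : Perm (Fin n)} {u v : Fin n → ℝ} {m : Fin n} {M : Fin n → Perm (Fin n)} {s : Store}
    (hs : HoldsAssignment c E u v σ s) (ht : HoldsTree m {m} M s)
    (hdone : s.nat DONE 0 0 0 = 0) (h : AlternatingTree c E σ m u v {m} M) {ρ : Perm (Fin n)}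
    (hρ : ∀ x, E x (ρ x)) :
    ∃ u' v' σ', DualCertificate c E u' v' σ' ∧ HoldsAssignment c E u' v' σ' (growTree.run s) := by
  have hinv := run_forLt (c := STEP) (p := branch (.natLe (.const 1) (.sc DONE)) skip treeStep)
    hs.size (fun k s' => ∃ u v, (1 ≤ s'.nat DONE 0 0 0 ∧ ∃ σ', DualCertificate c E u v σ' ∧
        HoldsAssignment c E u v σ' s') ∨
      (s'.nat DONE 0 0 0 = 0 ∧ ∃ T M, #T = k + 1 ∧
        AlternatingTree c E σ m u v T M ∧ HoldsAssignment c E u v σ s' ∧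
        HoldsTree m T M s')) ?_ ?_
  · obtain ⟨u', v', ⟨-, σ', hσ'⟩ | ⟨-, T', -, hT', -⟩⟩ := hinv
    · exact ⟨u', v', σ', hσ'⟩
    · have := card_finset_fin_le T'
      lia
  · refine ⟨u, v, .inr ⟨by simp [hdone], {m}, M, by simp, h, ?_, ?_⟩⟩
    · apply hs.congr <;> rfl
    · apply ht.congr <;> rfl
  · rintro k - s' - - ⟨u', v', ⟨hd, σ', hσ', hs'⟩ | ⟨hd, T, M, hT, hA, hs', ht'⟩⟩
    · refine ⟨u', v', .inl ⟨?_, σ', hσ', ?_⟩⟩ <;>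
        rw [run, if_pos (by simpa [BExp.Holds, NExp.eval] using hd), run]
      · simpa using hd
      · apply hs'.congr <;> rfl
    · rw [run, if_neg (by simp [BExp.Holds, NExp.eval, hd])]
      obtain ⟨u₁, v₁, ⟨hd₁, σ₁, hσ₁, hs₁⟩ | ⟨hd₁, T₁, M₁, hT₁, hA₁, hs₁, ht₁⟩⟩ :=
        run_treeStep hs' ht' hd hA hρ
      · refine ⟨u₁, v₁, .inl ⟨by simpa using hd₁, σ₁, hσ₁, ?_⟩⟩
        apply hs₁.congr <;> rfl
      · refine ⟨u₁, v₁, .inr ⟨by simpa using hd₁, T₁, M₁, by rw [hT₁, hT], hA₁, ?_, ?_⟩⟩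
        · apply hs₁.congr <;> rfl
        · apply ht₁.congr <;> rfl

/-- A positive number if a cycle cover of the remaining vertices may use the pair `(PHASE, CA)`, and
zero otherwise. -/
def pairExp : NExp :=
  -- `1` if the two vertices are equal, and `0` otherwise
  let eq : NExp := .sub (.const 1) (.add (.sub (.sc PHASE) (.sc CA)) (.sub (.sc CA) (.sc PHASE)))
  -- `1` if more than one vertex remains, and `0` otherwise
  let many : NExp := .sub (.const 1) (.sub (.const 1) (.sub (.sc COUNT) (.const 1)))
  .add
    (.sub (.sub (.add (entry ALIVE (.sc PHASE)) (entry ALIVE (.sc CA))) (.const 1)) eq)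
    (.sub eq (.sub (.add (entry ALIVE (.sc PHASE)) many) (.const 1)))

/-- Insert the row `PHASE` into the assignment problem. -/
def activateRow : SProg :=
  seq (fillReal CA COST (.sc PHASE) (.get WEIGHT (.const 0) (.sc PHASE) (.sc CA)))
    (fillNat CA PAIR (.sc PHASE) pairExp)

/-- Start the search from the row `PHASE`. -/
def initTree : SProg :=
  seq (fillNat CA TREE (.const 0) (.const 0))
    (seq (setNat TREE (.const 0) (.sc PHASE) (.const 0) (.const 1))
      (seq (fillNat CA SHIFTED (.sc PHASE) (entry COVER (.sc CA))) (assign DONE (.const 0))))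

/-- Insert the row `PHASE` and restore the optimality of the assignment. -/
def phase : SProg := seq activateRow (seq initTree growTree)

variable {n : ℕ} {w : Fin n → Fin n → ℝ} {A : Finset (Fin n)} {u v : Fin n → ℝ} {σ : Perm (Fin n)}

/-- The costs after `k` phases: the rows that have not been inserted yet cost nothing. -/
def phaseCost (w : Fin n → Fin n → ℝ) (k : ℕ) (x y : Fin n) : ℝ := if (x : ℕ) < k then w x y else 0

/-- The admissible pairs after `k` phases: the rows that have not been inserted yet admit all
columns. -/
def PhasePair (A : Finset (Fin n)) (k : ℕ) (x y : Fin n) : Prop := (x : ℕ) < k → CoverPair A x y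

/-- The memory holds the weights and the set `A` of the remaining vertices. -/
structure HoldsVertices (w : Fin n → Fin n → ℝ) (A : Finset (Fin n)) (s : Store) : Prop where
  size : s.nat 0 0 0 0 = n
  weight : ∀ x y : Fin n, s.real WEIGHT 0 x y = w x y
  alive : ∀ x : Fin n, s.nat ALIVE 0 x 0 = if x ∈ A then 1 else 0

theorem HoldsVertices.congr {s s' : Store} (h : HoldsVertices w A s)
    (h₀ : s'.nat 0 = s.nat 0) (h₁ : s'.real WEIGHT = s.real WEIGHT)
    (h₂ : s'.nat ALIVE = s.nat ALIVE) : HoldsVertices w A s' := by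
  constructor
  · rw [h₀, h.size]
  · rw [h₁]; exact h.weight
  · rw [h₂]; exact h.alive

theorem eval_pairExp {s : Store} (hA : HoldsVertices w A s) (hcount : s.nat COUNT 0 0 0 = #A)
    {x y : Fin n} (hx : s.nat PHASE 0 0 0 = x) (hy : s.nat CA 0 0 0 = y) :
    1 ≤ pairExp.eval s ↔ CoverPair A x y := by
  simp only [pairExp, NExp.eval, hx, hy, hA.alive, hcount, CoverPair]
  by_cases hxy : x = y
  · subst hxy
    split_ifs with h₁ <;> simp [h₁] <;> lia
  · have : (x : ℕ) ≠ y := fun e => hxy (Fin.ext e)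
    rw [if_neg hxy]
    split_ifs with h₁ h₂ h₂ <;> simp [h₁, h₂] <;> lia

theorem run_activateRow {s : Store} {m : Fin n}
    (hs : HoldsAssignment (phaseCost w m) (PhasePair A m) u v σ s) (hA : HoldsVertices w A s)
    (hcount : s.nat COUNT 0 0 0 = #A) (hm : s.nat PHASE 0 0 0 = m) :
    HoldsAssignment (phaseCost w (m + 1)) (PhasePair A (m + 1)) u v σ (activateRow.run s) := by
  have hlt : ∀ x : Fin n, x ≠ m → ((x : ℕ) < m + 1 ↔ (x : ℕ) < m) := fun x hx => by
    have := Fin.val_ne_of_ne hx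
    lia
  have hne : ∀ x : Fin n, x ≠ m → (x : ℕ) ≠ m := fun x hx => Fin.val_ne_of_ne hx
  have hcost := run_fillReal (n := n) (c := CA) (v := COST) (a := m) (i := .sc PHASE)
    (e := .get WEIGHT (.const 0) (.sc PHASE) (.sc CA)) hs.size
    (fun k => s.real WEIGHT 0 m k) ?_
  · have hpair := run_fillNat (n := n) (c := CA) (v := PAIR) (a := m) (i := .sc PHASE)
      (e := pairExp) (s := (fillReal CA COST (.sc PHASE)
        (.get WEIGHT (.const 0) (.sc PHASE) (.sc CA))).run s)
      (by rw [run_nat_of_notMem _ _ (by decide), hs.size]) (by decide)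
      (fun k => pairExp.eval (s.setNat CA 0 0 0 k)) ?_
    · refine ⟨?_, fun x y => ?_, fun x y => ?_, ?_, ?_, ?_⟩
      · rw [run_nat_of_notMem _ _ (by decide), hs.size]
      · rw [activateRow, run, run_real_of_notMem (fillNat _ _ _ _) _ (by decide)]
        by_cases hx : x = m
        · subst hx
          rw [hcost.1 y y.2, hA.weight, phaseCost, if_pos (Nat.lt_succ_self _)]
        · rw [hcost.2 x (hne x hx), hs.cost, phaseCost, phaseCost]
          simp only [hlt x hx]
      · rw [activateRow, run]
        by_cases hx : x = m
        · subst hx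
          have hev := eval_pairExp (s := s.setNat CA 0 0 0 y) (hA.congr rfl rfl rfl)
            (by simpa using hcount) (x := x) (y := y) (by simpa using hm) (by simp)
          rw [hpair.1 y y.2, hev]
          exact ⟨fun h _ => h, fun h => h (Nat.lt_succ_self _)⟩
        · rw [hpair.2 x (hne x hx), run_nat_of_notMem _ _ (by decide), hs.pair, PhasePair,
            PhasePair, hlt x hx]
      · rw [run_nat_of_notMem _ _ (by decide)]
        exact hs.cover
      · rw [run_real_of_notMem _ _ (by decide)]
        exact hs.rowpot
      · rw [run_real_of_notMem _ _ (by decide)]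
        exact hs.colpot
    · intro k hk s' hc hs' _ _ _
      have hfr : ∀ v ∉ [CA, PAIR], s'.nat v = s.nat v := fun v hv => by
        simp only [List.mem_cons, List.not_mem_nil, or_false, not_or] at hv
        rw [hs' v hv.1 hv.2, run_nat_of_notMem _ _ (by simpa [natWrites, fillReal] using hv.1)]
      simp only [pairExp, NExp.eval, hc, hfr PHASE (by decide), hfr ALIVE (by decide),
        hfr COUNT (by decide), Store.setNat_nat]
      simp [hm]
  · intro k hk s' hc hs' hs''
    simp [RExp.eval, NExp.eval, hc, hs' PHASE (by decide), hs'' WEIGHT (by decide), hm]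

theorem run_initTree {c : Fin n → Fin n → ℝ} {E : Fin n → Fin n → Prop} {s : Store} {m : Fin n}
    (hs : HoldsAssignment c E u v σ s) (hm : s.nat PHASE 0 0 0 = m) :
    HoldsTree m {m} (fun _ => σ) (initTree.run s) ∧ (initTree.run s).nat DONE 0 0 0 = 0 := by
  have htree := run_fillNat (n := n) (c := CA) (v := TREE) (a := 0) (i := .const 0)
    (e := .const 0) hs.size (by decide) (fun _ => 0) (by simp [NExp.eval])
  have hfr : ∀ v ∉ [CA, TREE], ((fillNat CA TREE (.const 0) (.const 0)).run s).nat v = s.nat v :=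
    fun v hv => run_nat_of_notMem _ _ hv
  unfold initTree
  rw [run_seq, run_seq, run_seq]
  revert htree hfr
  generalize (fillNat CA TREE (.const 0) (.const 0)).run s = s₁
  rintro ⟨htree, -⟩ hfr
  have hm₁ : s₁.nat PHASE 0 0 0 = m := by rw [hfr _ (by decide), hm]
  have hs₂ : (∀ v ∉ [CA, TREE], ((setNat TREE (.const 0) (.sc PHASE) (.const 0) (.const 1)).run
      s₁).nat v = s.nat v) ∧ ∀ x : Fin n, 1 ≤ ((setNat TREE (.const 0) (.sc PHASE) (.const 0)
        (.const 1)).run s₁).nat TREE 0 x 0 ↔ x = m := by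
    refine ⟨fun v hv => ?_, fun x => ?_⟩
    · rw [run, Store.setNat_nat_of_ne _ _ _ _ _ (fun e => hv (by simp [e])), hfr v hv]
    · by_cases hx : x = m
      · simp [run, NExp.eval, hm₁, hx]
      · simp [run, NExp.eval, hm₁, hx, Fin.val_inj, htree]
  revert hs₂
  generalize (setNat TREE (.const 0) (.sc PHASE) (.const 0) (.const 1)).run s₁ = s₂
  rintro ⟨hfr₂, htree₂⟩
  have hshift := run_fillNat (n := n) (c := CA) (v := SHIFTED) (a := m) (i := .sc PHASE)
    (e := entry COVER (.sc CA)) (s := s₂) (by rw [hfr₂ _ (by decide), hs.size]) (by decide)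
    (fun k => s₂.nat COVER 0 k 0) ?_
  · refine ⟨⟨?_, fun x => ?_, fun i hi x => ?_⟩, by simp [run, NExp.eval]⟩
    · rw [run_nat_of_notMem (assign _ _) _ (by decide), run_nat_of_notMem _ _ (by decide),
        hfr₂ _ (by decide), hm]
    · rw [run_nat_of_notMem (assign _ _) _ (by decide), run_nat_of_notMem _ _ (by decide),
        htree₂, mem_singleton]
    · rw [run_nat_of_notMem (assign _ _) _ (by decide), mem_singleton.1 hi,
        hshift.1 x x.2, hfr₂ _ (by decide), hs.cover]
  · intro k hk s' hc hs' _ _ _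
    simp only [NExp.eval, hc, hs' PHASE (by decide) (by decide), hs' COVER (by decide) (by decide)]
    rw [hfr₂ PHASE (by decide), hm]
    simp

theorem run_phase {s : Store} {m : Fin n}
    (hs : HoldsAssignment (phaseCost w m) (PhasePair A m) u v σ s)
    (h : DualCertificate (phaseCost w m) (PhasePair A m) u v σ) (hA : HoldsVertices w A s)
    (hcount : s.nat COUNT 0 0 0 = #A) (hm : s.nat PHASE 0 0 0 = m)
    {ρ : Perm (Fin n)} (hρ : ∀ x, CoverPair A x (ρ x)) :
    ∃ u' v' σ', DualCertificate (phaseCost w (m + 1)) (PhasePair A (m + 1)) u' v' σ' ∧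
      HoldsAssignment (phaseCost w (m + 1)) (PhasePair A (m + 1)) u' v' σ' (phase.run s) := by
  have hlt : ∀ x : Fin n, x ≠ m → ((x : ℕ) < m + 1 ↔ (x : ℕ) < m) := fun x hx => by
    have := Fin.val_ne_of_ne hx
    lia
  have hs₁ := run_activateRow hs hA hcount hm
  obtain ⟨ht, hdone⟩ := run_initTree hs₁ (m := m) (by rw [run_nat_of_notMem _ _ (by decide), hm])
  refine run_growTree (hs₁.congr ?_ ?_ ?_ ?_ ?_ ?_) ht hdone
    (h.alternatingTree (fun x hx y => ?_) (fun x hx y => ?_) rfl) (ρ := ρ) (fun x _ => hρ x)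
  any_goals exact run_nat_of_notMem _ _ (by decide)
  any_goals exact run_real_of_notMem _ _ (by decide)
  · simp only [phaseCost, hlt x hx]
  · simp only [PhasePair, hlt x hx]

end SProg

/-! ### The rounds of the reducer -/

namespace SProg

/-- The empty assignment problem, in which no row has been inserted. -/
def initAssignment : SProg :=
  seq (fillNat CA COVER (.const 0) (.sc CA))
    (seq (fillReal CA ROWPOT (.const 0) .zero)
      (seq (fillReal CA COLPOT (.const 0) .zero)
        (seq (forLt CB (fillReal CA COST (.sc CB) .zero))
          (forLt CB (fillNat CA PAIR (.sc CB) (.const 1))))))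

/-- Count the remaining vertices. -/
def countAlive : SProg :=
  seq (assign COUNT (.const 0)) (forLt CA (assign COUNT (.add (.sc COUNT) (entry ALIVE (.sc CA)))))

/-- Compute a cycle cover of smallest weight of the remaining vertices. -/
def coverCycles : SProg := seq countAlive (seq initAssignment (forLt PHASE phase))

/-- Follow the cycle of the vertex `CA`; it remains if no vertex of the cycle is smaller. -/
def testMinimum : SProg :=
  seq (assign CUR (.sc CA)) (seq (assign FLAG (entry ALIVE (.sc CA)))
    (seq (forLt CB (seq (assign CUR (entry COVER (.sc CUR)))
        (branch (.natLt (.sc CUR) (.sc CA)) (assign FLAG (.const 0)) skip)))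
      (setNat ALIVE (.const 0) (.sc CA) (.const 0) (.sc FLAG))))

/-- Keep the smallest vertex of each cycle. -/
def keepMinima : SProg := forLt CA testMinimum

/-- Cover the remaining vertices by cycles, keep one vertex of each cycle, and append the cover to
the composition of the earlier ones. -/
def round : SProg :=
  seq coverCycles (seq keepMinima (fillNat CA PATH (.const 0) (entry COVER (entry PATH (.sc CA)))))

variable {n : ℕ} {w : Fin n → Fin n → ℝ} {A : Finset (Fin n)} {u v : Fin n → ℝ} {σ : Perm (Fin n)}

theorem run_initAssignment {s : Store} (hn : s.nat 0 0 0 0 = n) (w : Fin n → Fin n → ℝ)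
    (A : Finset (Fin n)) :
    HoldsAssignment (phaseCost w 0) (PhasePair A 0) 0 0 1 (initAssignment.run s) := by
  unfold initAssignment
  rw [run_seq, run_seq, run_seq, run_seq]
  have h₁ := (run_fillNat (n := n) (c := CA) (v := COVER) (a := 0) (i := .const 0)
    (e := .sc CA) hn (by decide) (fun k => k) (by simp +contextual [NExp.eval])).1
  have hn₁ : ((fillNat CA COVER (.const 0) (.sc CA)).run s).nat 0 0 0 0 = n := by
    rw [run_nat_of_notMem _ _ (by decide), hn]
  revert h₁ hn₁
  generalize (fillNat CA COVER (.const 0) (.sc CA)).run s = s₁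
  intro h₁ hn₁
  have h₂ := (run_fillReal (n := n) (c := CA) (v := ROWPOT) (a := 0) (i := .const 0)
    (e := .zero) hn₁ (fun k => 0) (by simp [NExp.eval, RExp.eval])).1
  have hn₂ : ((fillReal CA ROWPOT (.const 0) .zero).run s₁).nat 0 0 0 0 = n := by
    rw [run_nat_of_notMem _ _ (by decide), hn₁]
  replace h₁ : ∀ x < n, ((fillReal CA ROWPOT (.const 0) .zero).run s₁).nat COVER 0 x 0 = x := by
    rwa [run_nat_of_notMem _ _ (by decide)]
  revert h₁ h₂ hn₂
  generalize (fillReal CA ROWPOT (.const 0) .zero).run s₁ = s₂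
  intro h₂ hn₂ h₁
  have h₃ := (run_fillReal (n := n) (c := CA) (v := COLPOT) (a := 0) (i := .const 0)
    (e := .zero) hn₂ (fun k => 0) (by simp [NExp.eval, RExp.eval])).1
  have hn₃ : ((fillReal CA COLPOT (.const 0) .zero).run s₂).nat 0 0 0 0 = n := by
    rw [run_nat_of_notMem _ _ (by decide), hn₂]
  have h₄ := run_forLt (c := CB) (p := fillReal CA COST (.sc CB) .zero) hn₃
    (fun k s' => ∀ x < k, ∀ y < n, s'.real COST 0 x y = 0) (by simp) ?_
  · have h₅ := run_forLt (c := CB) (p := fillNat CA PAIR (.sc CB) (.const 1))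
      (s := (forLt CB (fillReal CA COST (.sc CB) .zero)).run
        ((fillReal CA COLPOT (.const 0) .zero).run s₂))
      (by rw [run_nat_of_notMem _ _ (by decide), hn₃])
      (fun k s' => ∀ x < k, ∀ y < n, s'.nat PAIR x y 0 = 1) (by simp) ?_
    · refine ⟨?_, fun x y => ?_, fun x y => ?_, fun x => ?_, fun x => ?_, fun x => ?_⟩
      · rw [run_nat_of_notMem _ _ (by decide), run_nat_of_notMem _ _ (by decide), hn₃]
      · rw [run_real_of_notMem _ _ (by decide), h₄ x x.2 y y.2]
        simp [phaseCost]
      · rw [h₅ x x.2 y y.2]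
        simp [PhasePair]
      · rw [run_nat_of_notMem _ _ (by decide), run_nat_of_notMem _ _ (by decide),
          run_nat_of_notMem _ _ (by decide), h₁ x x.2]
        rfl
      · rw [run_real_of_notMem _ _ (by decide), run_real_of_notMem _ _ (by decide),
          run_real_of_notMem _ _ (by decide), h₂ x x.2]
        rfl
      · rw [run_real_of_notMem _ _ (by decide), run_real_of_notMem _ _ (by decide), h₃ x x.2]
        rfl
    · intro k hk s' hs' hc ih x hx y hy
      have hfill := run_fillNat (n := n) (c := CA) (v := PAIR) (a := k) (i := .sc CB)
        (e := .const 1) (s := s')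
        (by rw [hs'.nat _ (by decide), run_nat_of_notMem _ _ (by decide), hn₃]) (by decide)
        (fun k => 1) (fun k' _ s'' _ h _ _ _ => by
          simp [NExp.eval, h CB (by decide) (by decide), hc])
      rw [Store.setNat_nat_of_ne _ _ _ _ _ (by decide)]
      by_cases hxk : x = k
      · rw [hxk, hfill.1 y hy]
      · rw [hfill.2 x hxk, ih x (by lia) y hy]
  · intro k hk s' hs' hc ih x hx y hy
    have hfill := run_fillReal (n := n) (c := CA) (v := COST) (a := k) (i := .sc CB)
      (e := .zero) (s := s') (by rw [hs'.nat _ (by decide), hn₃])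
      (fun k => 0) (fun k' _ s'' _ h _ => by
        simp [NExp.eval, RExp.eval, h CB (by decide), hc])
    rw [Store.setNat_real]
    by_cases hxk : x = k
    · rw [hxk, hfill.1 y hy]
    · rw [hfill.2 x hxk, ih x (by lia) y hy]

theorem run_countAlive {s : Store} (hA : HoldsVertices w A s) :
    (countAlive.run s).nat COUNT 0 0 0 = #A := by
  have h := run_forLt (n := n) (c := CA)
    (p := assign COUNT (.add (.sc COUNT) (entry ALIVE (.sc CA))))
    (s := (assign COUNT (.const 0)).run s) (by simp [run, NExp.eval, hA.size])
    (fun k s' => s'.nat COUNT 0 0 0 = #(A.filter fun x : Fin n => (x : ℕ) < k)) (by simp [run, NExp.eval]) ?_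
  · rw [countAlive, run_seq, h, filter_true_of_mem fun x _ => x.2]
  · intro k hk s' hs' hc ih
    have hal : s'.nat ALIVE 0 k 0 = if (⟨k, hk⟩ : Fin n) ∈ A then 1 else 0 := by
      rw [hs'.nat _ (by decide), run_nat_of_notMem _ _ (by decide), ← hA.alive]
    have hset : A.filter (fun x : Fin n => (x : ℕ) < k + 1) =
        if (⟨k, hk⟩ : Fin n) ∈ A then insert ⟨k, hk⟩ (A.filter fun x : Fin n => (x : ℕ) < k)
        else A.filter fun x : Fin n => (x : ℕ) < k := by
      ext x
      have hx : (x : ℕ) < k + 1 ↔ (x : ℕ) < k ∨ x = ⟨k, hk⟩ := by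
        rw [Fin.ext_iff, Nat.lt_succ_iff_lt_or_eq]
      split_ifs with h <;> simp only [mem_filter, mem_insert, hx]
      · constructor
        · tauto
        · rintro (rfl | h') <;> tauto
      · constructor
        · rintro ⟨h', h'' | rfl⟩ <;> tauto
        · tauto
    rw [hset]
    by_cases h : (⟨k, hk⟩ : Fin n) ∈ A <;> simp [run, NExp.eval, hc, ih, hal, h]

/-- The program computes an assignment that is optimal among the cycle covers. -/
theorem run_coverCycles {s : Store} (hA : HoldsVertices w A s) {ρ : Perm (Fin n)}
    (hρ : ∀ x, CoverPair A x (ρ x)) :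
    ∃ u v σ, DualCertificate w (CoverPair A) u v σ ∧
      ∀ x : Fin n, (coverCycles.run s).nat COVER 0 x 0 = σ x := by
  have hcount := run_countAlive hA
  have hinit := run_initAssignment (s := countAlive.run s)
    (by rw [run_nat_of_notMem _ _ (by decide), hA.size]) w A
  have hloop := run_forLt (n := n) (c := PHASE) (p := phase)
    (s := initAssignment.run (countAlive.run s)) hinit.size
    (fun k s' => ∃ u v σ, DualCertificate (phaseCost w k) (PhasePair A k) u v σ ∧
      HoldsAssignment (phaseCost w k) (PhasePair A k) u v σ s') ?_ ?_
  · obtain ⟨u, v, σ, h, hs⟩ := hloop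
    refine ⟨u, v, σ, ?_, hs.cover⟩
    have h₁ : phaseCost w n = w := by
      funext x y
      exact if_pos x.2
    have h₂ : PhasePair A n = CoverPair A := by
      funext x y
      exact propext ⟨fun h => h x.2, fun h _ => h⟩
    rwa [h₁, h₂] at h
  · refine ⟨0, 0, 1, ⟨fun x y _ => ?_, fun x h => ?_, fun x => ?_⟩, hinit.congr rfl rfl rfl rfl rfl rfl⟩
    · simp [phaseCost]
    · exact absurd h (Nat.not_lt_zero _)
    · simp [phaseCost]
  · rintro k hk s' hs' hc ⟨u, v, σ, h, hs⟩
    have hA' : HoldsVertices w A s' := by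
      apply hA.congr
      · rw [hs'.nat _ (by decide), run_nat_of_notMem _ _ (by decide),
          run_nat_of_notMem _ _ (by decide)]
      · rw [hs'.real _ (by decide), run_real_of_notMem _ _ (by decide),
          run_real_of_notMem _ _ (by decide)]
      · rw [hs'.nat _ (by decide), run_nat_of_notMem _ _ (by decide),
          run_nat_of_notMem _ _ (by decide)]
    have hcount' : s'.nat COUNT 0 0 0 = #A := by
      rw [hs'.nat _ (by decide), run_nat_of_notMem _ _ (by decide), hcount]
    obtain ⟨u', v', σ', h', hs''⟩ := run_phase (m := ⟨k, hk⟩) hs h hA' hcount' hc hρ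
    exact ⟨u', v', σ', h', hs''.congr rfl rfl rfl rfl rfl rfl⟩

theorem mem_cycleMinima_iff_pow {x : Fin n} :
    x ∈ cycleMinima σ A ↔ x ∈ A ∧ ∀ i ≤ n, x ≤ (σ ^ i) x := by
  rw [mem_cycleMinima]
  refine and_congr_right fun _ => ⟨fun h i _ => h _ ⟨i, by simp⟩, fun h y hy => ?_⟩
  by_cases hx : x ∈ σ.support
  · obtain ⟨i, hi, rfl⟩ := Perm.SameCycle.exists_pow_eq_of_mem_support hy hx
    exact h i (hi.le.trans ((card_le_univ _).trans_eq (Fintype.card_fin n)))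
  · obtain ⟨i, rfl⟩ := hy
    rw [Perm.zpow_apply_eq_self_of_apply_eq_self (Perm.notMem_support.1 hx)]

theorem run_testMinimum {s : Store} (hn : s.nat 0 0 0 0 = n)
    (hσ : ∀ x : Fin n, s.nat COVER 0 x 0 = σ x) {x : Fin n} (hx : s.nat CA 0 0 0 = x)
    (hA : s.nat ALIVE 0 x 0 = if x ∈ A then 1 else 0) :
    ∀ y : ℕ, (testMinimum.run s).nat ALIVE 0 y 0 =
      if y = x then if x ∈ cycleMinima σ A then 1 else 0 else s.nat ALIVE 0 y 0 := by
  set s₁ := (assign FLAG (entry ALIVE (.sc CA))).run ((assign CUR (.sc CA)).run s) with hs₁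
  have hcur : s₁.nat CUR 0 0 0 = x := by simp [hs₁, run, NExp.eval, hx]
  have hflag : s₁.nat FLAG 0 0 0 = if x ∈ A then 1 else 0 := by
    simp [hs₁, run, NExp.eval, hx, hA]
  have hfr : ∀ v ∉ [FLAG, CUR], s₁.nat v = s.nat v := fun v hv => by
    rw [hs₁, ← run_seq, run_nat_of_notMem]
    simpa [natWrites, or_comm] using hv
  have hloop := run_forLt (n := n) (c := CB) (p := seq (assign CUR (entry COVER (.sc CUR)))
        (branch (.natLt (.sc CUR) (.sc CA)) (assign FLAG (.const 0)) skip)) (s := s₁)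
    (by rw [hfr _ (by decide), hn])
    (fun k s' => s'.nat CUR 0 0 0 = ((σ ^ k) x : Fin n) ∧
      s'.nat FLAG 0 0 0 = if x ∈ A ∧ ∀ i ≤ k, x ≤ (σ ^ i) x then 1 else 0) ?_ ?_
  · intro y
    rw [testMinimum, run_seq, run_seq, run_seq, ← hs₁]
    revert hloop
    have hfr₂ : ∀ v ∉ [CB, CUR, FLAG], ((forLt CB (seq (assign CUR (entry COVER (.sc CUR)))
        (branch (.natLt (.sc CUR) (.sc CA)) (assign FLAG (.const 0)) skip))).run s₁).nat v =
        s₁.nat v := fun v hv => run_nat_of_notMem _ _ (by simpa [natWrites] using hv)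
    revert hfr₂
    generalize (forLt CB (seq (assign CUR (entry COVER (.sc CUR)))
        (branch (.natLt (.sc CUR) (.sc CA)) (assign FLAG (.const 0)) skip))).run s₁ = s₂
    rintro hfr₂ ⟨-, hf⟩
    simp [run, NExp.eval, hfr₂, hfr, hx, hf, mem_cycleMinima_iff_pow]
  · simp [hcur, hflag]
  · rintro k hk s' hs' - ⟨h₁, h₂⟩
    have hca : s'.nat CA 0 0 0 = x := by rw [hs'.nat _ (by decide), hfr _ (by decide), hx]
    have hcov : s'.nat COVER 0 ((σ ^ k) x : Fin n) 0 = ((σ ^ (k + 1)) x : Fin n) := by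
      rw [hs'.nat _ (by decide), hfr _ (by decide), hσ, pow_succ', Perm.mul_apply]
    have hle : (∀ i ≤ k + 1, x ≤ (σ ^ i) x) ↔
        (∀ i ≤ k, x ≤ (σ ^ i) x) ∧ x ≤ (σ ^ (k + 1)) x := by
      refine ⟨fun h => ⟨fun i hi => h i (by lia), h _ le_rfl⟩, fun h i hi => ?_⟩
      obtain h' | rfl := Nat.le_succ_iff.1 hi
      · exact h.1 i h'
      · exact h.2
    rw [run_seq]
    have hs₃ : (assign CUR (entry COVER (.sc CUR))).run s' =
        s'.setNat CUR 0 0 0 ((σ ^ (k + 1)) x : Fin n) := by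
      simp [run, NExp.eval, h₁, hcov]
    rw [hs₃, run]
    by_cases hlt : (σ ^ (k + 1)) x < x
    · rw [if_pos (by simpa [BExp.Holds, NExp.eval, hca, Nat.succ_le_iff] using hlt)]
      simp [run, NExp.eval, hle, hlt]
    · rw [if_neg (by simpa [BExp.Holds, NExp.eval, hca, Nat.succ_le_iff] using hlt)]
      simp [run, hle, not_lt.1 hlt, h₂]

theorem run_keepMinima {s : Store} (hA : HoldsVertices w A s)
    (hσ : ∀ x : Fin n, s.nat COVER 0 x 0 = σ x) :
    HoldsVertices w (cycleMinima σ A) (keepMinima.run s) := by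
  have hloop := run_forLt (n := n) (c := CA) (p := testMinimum) hA.size
    (fun k s' => ∀ x : Fin n, s'.nat ALIVE 0 x 0 =
      if (x : ℕ) < k then if x ∈ cycleMinima σ A then 1 else 0 else if x ∈ A then 1 else 0) ?_ ?_
  · refine ⟨?_, ?_, fun x => ?_⟩
    · rw [run_nat_of_notMem _ _ (by decide), hA.size]
    · rw [run_real_of_notMem _ _ (by decide)]
      exact hA.weight
    · rw [keepMinima, hloop x, if_pos x.2]
  · simpa using hA.alive
  · intro k hk s' hs' hc ih x
    have h := run_testMinimum (A := A) (x := ⟨k, hk⟩) (by rw [hs'.nat _ (by decide), hA.size])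
      (by rw [hs'.nat _ (by decide)]; exact hσ) hc (by rw [ih]; simp)
    rw [Store.setNat_nat_of_ne _ _ _ _ _ (by decide), h, ih]
    by_cases hx : x = ⟨k, hk⟩
    · simp [hx]
    · have := Fin.val_ne_of_ne hx
      simp only at this
      rw [if_neg this]
      congr 1
      rw [eq_iff_iff]
      lia

/-- What the rounds have computed so far: the set `A` of the vertices that are left, and the
composition `p` of the cycle covers, which completes every cycle `τ` on `A` to a cycle `τ * p` on
all vertices. -/
structure HoldsPartialSolution (I : SemiMetricTSP) (k : ℕ) (A : Finset (Fin I.n))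
    (p : Perm (Fin I.n)) (s : Store) : Prop extends HoldsVertices I.w A s where
  path : ∀ x : Fin I.n, s.nat PATH 0 x 0 = p x
  card_le : 2 ^ k * #A ≤ I.n + 2 ^ k
  cyclicOn : ∀ τ, CyclicOn τ A → CyclicOn (τ * p) univ
  permCost_le : ∀ τ, CyclicOn τ A → permCost I.w univ (τ * p) ≤ permCost I.w A τ + k * I.opt

theorem run_round {I : SemiMetricTSP} {k : ℕ} {A : Finset (Fin I.n)} {p : Perm (Fin I.n)}
    {s : Store} (h : HoldsPartialSolution I k A p s) :
    ∃ A' p', HoldsPartialSolution I (k + 1) A' p' (round.run s) := by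
  obtain ⟨ρ, hρ, -⟩ := I.exists_cyclicOn_permCost_le_opt A
  obtain ⟨u, v, σ, hcert, hσ⟩ := run_coverCycles h.toHoldsVertices hρ.coverPair
  have hA : HoldsVertices I.w A (coverCycles.run s) :=
    h.toHoldsVertices.congr (run_nat_of_notMem _ _ (by decide)) (run_real_of_notMem _ _ (by decide))
      (run_nat_of_notMem _ _ (by decide))
  have hA' := run_keepMinima hA hσ
  have hσ' : ∀ x : Fin I.n, (keepMinima.run (coverCycles.run s)).nat COVER 0 x 0 = σ x := by
    rwa [run_nat_of_notMem _ _ (by decide)]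
  have hpath : ∀ x : Fin I.n, (keepMinima.run (coverCycles.run s)).nat PATH 0 x 0 = p x := by
    rw [run_nat_of_notMem _ _ (by decide), run_nat_of_notMem _ _ (by decide)]
    exact h.path
  rw [round, run_seq, run_seq]
  clear hA hσ
  revert hA' hσ' hpath
  generalize keepMinima.run (coverCycles.run s) = s₁
  intro hA' hσ' hpath
  have hfill := (run_fillNat (n := I.n) (c := CA) (v := PATH) (a := 0) (i := .const 0)
    (e := entry COVER (entry PATH (.sc CA))) hA'.size (by decide)
    (fun k => s₁.nat COVER 0 (s₁.nat PATH 0 k 0) 0) ?_).1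
  · have hfix := fixes_of_coverPair hcert.admissible
    have hcyc : ∀ τ, CyclicOn τ (cycleMinima σ A) → CyclicOn (τ * σ) A := fun τ hτ =>
      hτ.mul (cycleMinima_subset σ A) hfix (fun x hx => exists_mem_cycleMinima hfix hx)
        fun x hx y hy => eq_of_mem_cycleMinima hx hy
    refine ⟨cycleMinima σ A, σ * p, ⟨hA'.congr ?_ ?_ ?_, fun x => ?_, ?_, fun τ hτ => ?_,
      fun τ hτ => ?_⟩⟩
    any_goals exact run_nat_of_notMem _ _ (by decide)
    any_goals exact run_real_of_notMem _ _ (by decide)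
    · rw [hfill x x.2, hpath, hσ', Perm.mul_apply]
    · have h₁ := Nat.mul_le_mul_left (2 ^ k) (two_mul_card_cycleMinima_le_of_coverPair
        hcert.admissible)
      have h₂ := h.card_le
      rw [pow_succ]
      linarith
    · rw [← mul_assoc]
      exact h.cyclicOn _ (hcyc τ hτ)
    · rw [← mul_assoc]
      have h₁ := h.permCost_le _ (hcyc τ hτ)
      have h₂ := permCost_mul_le I.triangle (cycleMinima_subset σ A) hfix hτ.fixes
      have h₃ := permCost_le_opt_of_dualCertificate I hcert
      push_cast
      linarith
  · intro k hk s' hc hs' _ _ hrow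
    simp only [NExp.eval, hc, hs' COVER (by decide) (by decide), hrow k le_rfl, and_self]

/-- All rounds of the reducer. -/
def rounds : ℕ → SProg
  | 0 => seq (fillNat CA ALIVE (.const 0) (.const 1)) (fillNat CA PATH (.const 0) (.sc CA))
  | k + 1 => seq (rounds k) round

theorem run_rounds (I : SemiMetricTSP) (k : ℕ) :
    ∃ A p, HoldsPartialSolution I k A p ((rounds k).run I.inputStore) := by
  induction k with
  | zero =>
    have h₁ := (run_fillNat (n := I.n) (c := CA) (v := ALIVE) (a := 0) (i := .const 0)
      (e := .const 1) (s := I.inputStore) (by simp [SemiMetricTSP.inputStore]) (by decide)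
      (fun _ => 1) (by simp [NExp.eval])).1
    have hn : ((fillNat CA ALIVE (.const 0) (.const 1)).run I.inputStore).nat 0 0 0 0 = I.n := by
      rw [run_nat_of_notMem _ _ (by decide)]
      simp [SemiMetricTSP.inputStore]
    have h₂ := (run_fillNat (n := I.n) (c := CA) (v := PATH) (a := 0) (i := .const 0)
      (e := .sc CA) hn (by decide) (fun k => k) (by simp +contextual [NExp.eval])).1
    refine ⟨univ, 1, ⟨⟨?_, fun x y => ?_, fun x => ?_⟩, fun x => ?_, ?_, fun τ hτ => ?_,
      fun τ hτ => ?_⟩⟩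
    · rw [rounds, run_seq, run_nat_of_notMem _ _ (by decide), hn]
    · rw [rounds, run_real_of_notMem _ _ (by decide)]
      simp [SemiMetricTSP.inputStore]
    · rw [rounds, run_seq, run_nat_of_notMem _ _ (by decide), h₁ x x.2, if_pos (mem_univ x)]
    · rw [rounds, run_seq, h₂ x x.2]
      rfl
    · simp
    · simpa using hτ
    · simp
  | succ k ih =>
    obtain ⟨A, p, h⟩ := ih
    exact run_round h

end SProg

/-! ### Reducer and merger -/

namespace SProg

/-- List the remaining vertices. -/
def listVertices : SProg :=
  seq (assign COUNT (.const 0)) (forLt CA (branch (.natLe (.const 1) (entry ALIVE (.sc CA)))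
    (seq (setNat REP (.const 0) (.sc COUNT) (.const 0) (.sc CA))
      (assign COUNT (.add (.sc COUNT) (.const 1))))
    skip))

/-- Write the instance that the remaining vertices induce. -/
def writeInstance : SProg :=
  seq (assign 1 (.const 1)) (seq (assign 2 (.sc COUNT))
    (forLt CB (fillReal CA OUTPUT (.sc CB)
      (.get WEIGHT (.const 0) (entry REP (.sc CB)) (entry REP (.sc CA))))))

/-- The reducer makes `k` rounds and outputs the single instance that is left. -/
def reducer (k : ℕ) : SProg := seq (rounds k) (seq listVertices writeInstance)

/-- Store the successor of the vertex `CA` of the given tour. -/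
def linkVertex : SProg :=
  branch (.natLt (.sc CA) (.sc 2))
    (branch (.natLt (.add (.sc CA) (.const 1)) (.sc 2))
      (setNat SUCC (.const 0) (entry REP (.get 3 (.const 0) (.sc CA) (.const 0))) (.const 0)
        (entry REP (.get 3 (.const 0) (.add (.sc CA) (.const 1)) (.const 0))))
      (setNat SUCC (.const 0) (entry REP (.get 3 (.const 0) (.sc CA) (.const 0))) (.const 0)
        (entry REP (.get 3 (.const 0) (.const 0) (.const 0)))))
    skip

/-- Write the next vertex of the tour, and move on to its successor. -/
def visitVertex : SProg :=
  seq (setNat 4 (.sc CA) (.const 0) (.const 0) (.sc CUR))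
    (assign CUR (entry SUCC (entry PATH (.sc CUR))))

/-- The merger stores the given tour by successors, fixing the other vertices, and then follows the
composition of this permutation with the cycle covers from the vertex `0`. -/
def merger : SProg :=
  seq (fillNat CA SUCC (.const 0) (.sc CA)) (seq (forLt CA linkVertex)
    (seq (assign CUR (.const 0)) (forLt CA visitVertex)))

variable {n : ℕ} {w : Fin n → Fin n → ℝ} {A : Finset (Fin n)}

theorem run_listVertices {s : Store} (hA : HoldsVertices w A s) :
    ∃ (m : ℕ) (e : Fin m ↪ Fin n), univ.map e = A ∧ (listVertices.run s).nat COUNT 0 0 0 = m ∧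
      ∀ i : Fin m, (listVertices.run s).nat REP 0 i 0 = e i := by
  have h := run_forLt (n := n) (c := CA) (p := branch (.natLe (.const 1) (entry ALIVE (.sc CA)))
    (seq (setNat REP (.const 0) (.sc COUNT) (.const 0) (.sc CA))
      (assign COUNT (.add (.sc COUNT) (.const 1)))) skip)
    (s := (assign COUNT (.const 0)).run s) (by simp [run, NExp.eval, hA.size])
    (fun k s' => (∀ i < s'.nat COUNT 0 0 0, ∃ x ∈ A, (x : ℕ) < k ∧ s'.nat REP 0 i 0 = x) ∧
      (∀ x ∈ A, (x : ℕ) < k → ∃ i < s'.nat COUNT 0 0 0, s'.nat REP 0 i 0 = x) ∧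
      ∀ i < s'.nat COUNT 0 0 0, ∀ j < s'.nat COUNT 0 0 0,
        s'.nat REP 0 i 0 = s'.nat REP 0 j 0 → i = j) (by simp [run, NExp.eval]) ?_
  · rw [listVertices, run_seq]
    obtain ⟨h₁, h₂, h₃⟩ := h
    choose f hfA _ hf using fun i : Fin _ => h₁ i i.2
    have hinj : Function.Injective f := fun i j hij =>
      Fin.ext (h₃ i i.2 j j.2 (by rw [hf, hf, hij]))
    refine ⟨_, ⟨f, hinj⟩, ?_, rfl, hf⟩
    ext x
    simp only [mem_map, mem_univ, true_and]
    refine ⟨?_, fun hx => ?_⟩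
    · rintro ⟨i, rfl⟩
      exact hfA i
    · obtain ⟨i, hi, hix⟩ := h₂ x hx x.2
      exact ⟨⟨i, hi⟩, Fin.ext ((hf ⟨i, hi⟩).symm.trans hix)⟩
  · rintro k hk s' hs' hc ⟨h₁, h₂, h₃⟩
    have hal : s'.nat ALIVE 0 k 0 = if (⟨k, hk⟩ : Fin n) ∈ A then 1 else 0 := by
      rw [hs'.nat _ (by decide), run_nat_of_notMem _ _ (by decide), ← hA.alive]
    generalize hN : s'.nat COUNT 0 0 0 = N at h₁ h₂ h₃
    have hlt : ∀ x : Fin n, (x : ℕ) < k + 1 → (x : ℕ) < k ∨ x = ⟨k, hk⟩ := fun x hx => by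
      rw [Fin.ext_iff]
      exact Nat.lt_succ_iff_lt_or_eq.1 hx
    by_cases hkA : (⟨k, hk⟩ : Fin n) ∈ A
    · rw [run, if_pos (by simp [BExp.Holds, NExp.eval, hc, hal, hkA])]
      have hcount : (((seq (setNat REP (.const 0) (.sc COUNT) (.const 0) (.sc CA))
          (assign COUNT (.add (.sc COUNT) (.const 1)))).run s').setNat CA 0 0 0 (k + 1)).nat
          COUNT 0 0 0 = N + 1 := by simp [run, NExp.eval, hN]
      have hrep : ∀ i, (((seq (setNat REP (.const 0) (.sc COUNT) (.const 0) (.sc CA))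
          (assign COUNT (.add (.sc COUNT) (.const 1)))).run s').setNat CA 0 0 0 (k + 1)).nat
          REP 0 i 0 = if i = N then k else s'.nat REP 0 i 0 := by
        simp [run, NExp.eval, hN, hc]
      have hsmall : ∀ i < N, s'.nat REP 0 i 0 < k := fun i hi => by
        obtain ⟨x, _, hx, h⟩ := h₁ i hi
        rwa [h]
      simp only [hcount, hrep]
      refine ⟨fun i hi => ?_, fun x hx hxk => ?_, fun i hi j hj => ?_⟩
      · split_ifs with hiN
        · exact ⟨⟨k, hk⟩, hkA, Nat.lt_succ_self _, rfl⟩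
        · obtain ⟨x, hx, hxk, h⟩ := h₁ i (by lia)
          exact ⟨x, hx, by lia, h⟩
      · obtain hxk | rfl := hlt x hxk
        · obtain ⟨i, hi, h⟩ := h₂ x hx hxk
          exact ⟨i, by lia, by rw [if_neg (by lia), h]⟩
        · exact ⟨N, by lia, by rw [if_pos rfl]⟩
      · have hi' := hsmall i
        have hj' := hsmall j
        split_ifs with h₄ h₅ h₅
        · lia
        · intro h
          have := hj' (by lia)
          lia
        · intro h
          have := hi' (by lia)
          lia
        · exact h₃ i (by lia) j (by lia)
    · rw [run, if_neg (by simp [BExp.Holds, NExp.eval, hc, hal, hkA]), run]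
      have hcount : (s'.setNat CA 0 0 0 (k + 1)).nat COUNT 0 0 0 = N := by simp [hN]
      have hrep : ∀ i, (s'.setNat CA 0 0 0 (k + 1)).nat REP 0 i 0 = s'.nat REP 0 i 0 := by simp
      simp only [hcount, hrep]
      refine ⟨fun i hi => ?_, fun x hx hxk => ?_, h₃⟩
      · obtain ⟨x, hx, hxk, h⟩ := h₁ i hi
        exact ⟨x, hx, by lia, h⟩
      · obtain hxk | rfl := hlt x hxk
        · exact h₂ x hx hxk
        · exact absurd hx hkA

theorem run_writeInstance {s : Store} (hA : HoldsVertices w A s) {m : ℕ} {e : Fin m ↪ Fin n}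
    (hrep : ∀ i : Fin m, s.nat REP 0 i 0 = e i) (x y : Fin m) :
    (writeInstance.run s).real OUTPUT 0 x y = w (e x) (e y) := by
  have hm : m ≤ n := by simpa using Fintype.card_le_of_embedding e
  have h := run_forLt (n := n) (c := CB) (p := fillReal CA OUTPUT (.sc CB)
      (.get WEIGHT (.const 0) (entry REP (.sc CB)) (entry REP (.sc CA))))
    (s := (assign 2 (.sc COUNT)).run ((assign 1 (.const 1)).run s))
    (by simp [run, NExp.eval, hA.size])
    (fun k s' => ∀ x < k, ∀ y < n, s'.real OUTPUT 0 x y =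
      s.real WEIGHT 0 (s.nat REP 0 x 0) (s.nat REP 0 y 0)) (by simp) ?_
  · rw [writeInstance, run_seq, run_seq, h x (by lia) y (by lia), hrep, hrep, hA.weight]
  · intro k hk s' hs' hc ih x hx y hy
    have hn' : s'.nat 0 0 0 0 = n := by
      rw [hs'.nat _ (by decide), run_nat_of_notMem _ _ (by decide),
        run_nat_of_notMem _ _ (by decide), hA.size]
    have hrep' : s'.nat REP = s.nat REP := by
      rw [hs'.nat _ (by decide), run_nat_of_notMem _ _ (by decide),
        run_nat_of_notMem _ _ (by decide)]
    have hw : s'.real WEIGHT = s.real WEIGHT := by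
      rw [hs'.real _ (by decide), run_real_of_notMem _ _ (by decide),
        run_real_of_notMem _ _ (by decide)]
    have hfill := run_fillReal (n := n) (c := CA) (v := OUTPUT) (a := k) (i := .sc CB)
      (e := .get WEIGHT (.const 0) (entry REP (.sc CB)) (entry REP (.sc CA))) hn'
      (fun y => s.real WEIGHT 0 (s.nat REP 0 k 0) (s.nat REP 0 y 0))
      (fun k' _ s'' hc' h h' => by
        simp [NExp.eval, RExp.eval, h CB (by decide), hc, hc', h REP (by decide), hrep',
          h' WEIGHT (by decide), hw])
    rw [Store.setNat_real]
    by_cases hxk : x = k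
    · rw [hxk, hfill.1 y hy]
    · rw [hfill.2 x hxk, ih x (by lia) y hy]

theorem coe_finRotate_eq_ite {m : ℕ} (i : Fin m) :
    (finRotate m i : ℕ) = if (i : ℕ) + 1 < m then (i : ℕ) + 1 else 0 := by
  obtain _ | m := m
  · exact i.elim0
  · rw [coe_finRotate]
    have := i.2
    simp only [Fin.ext_iff, Fin.val_last]
    split_ifs <;> lia

section Merger

variable {m : ℕ} {e : Fin m ↪ Fin n} {S : Perm (Fin m)}

theorem run_linkVertex {s : Store} (hm : s.nat 2 0 0 0 = m)
    (hrep : ∀ i : Fin m, s.nat REP 0 i 0 = e i) (hS : ∀ i : Fin m, s.nat 3 0 i 0 = S i)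
    {k : ℕ} (hk : s.nat CA 0 0 0 = k) (x : ℕ) :
    (linkVertex.run s).nat SUCC 0 x 0 =
      if h : k < m then
        if x = e (S ⟨k, h⟩) then (e (S (finRotate m ⟨k, h⟩)) : ℕ) else s.nat SUCC 0 x 0
      else s.nat SUCC 0 x 0 := by
  unfold linkVertex
  rw [run]
  by_cases h : k < m
  · rw [if_pos (by simpa [BExp.Holds, NExp.eval, hk, hm] using h), dif_pos h, run]
    have hk' : s.nat 3 0 k 0 = S ⟨k, h⟩ := hS ⟨k, h⟩
    have hrot := coe_finRotate_eq_ite (⟨k, h⟩ : Fin m)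
    simp only at hrot
    split_ifs at hrot with h'
    · have hnext : s.nat 3 0 (k + 1) 0 = S (finRotate m ⟨k, h⟩) := by rw [← hS, hrot]
      rw [if_pos (by simpa [BExp.Holds, NExp.eval, hk, hm] using h')]
      simp [run, NExp.eval, hk, hk', hnext, hrep]
    · have hnext : s.nat 3 0 0 0 = S (finRotate m ⟨k, h⟩) := by rw [← hS, hrot]
      rw [if_neg (by simpa [BExp.Holds, NExp.eval, hk, hm] using h')]
      simp [run, NExp.eval, hk, hk', hnext, hrep]
  · rw [if_neg (by simpa [BExp.Holds, NExp.eval, hk, hm] using h), dif_neg h, run]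

theorem run_linkTour {s : Store} (hn : s.nat 0 0 0 0 = n) (hm : s.nat 2 0 0 0 = m)
    (hrep : ∀ i : Fin m, s.nat REP 0 i 0 = e i) (hS : ∀ i : Fin m, s.nat 3 0 i 0 = S i)
    (hsucc : ∀ x < n, s.nat SUCC 0 x 0 = x) (x : Fin n) :
    ((forLt CA linkVertex).run s).nat SUCC 0 x 0 =
      (S * finRotate m * S⁻¹ : Perm (Fin m)).viaEmbedding e x := by
  have hmn : m ≤ n := by simpa using Fintype.card_le_of_embedding e
  have h := run_forLt (n := n) (c := CA) (p := linkVertex) hn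
    (fun k s' => (∀ x : Fin n, x ∉ Set.range e → s'.nat SUCC 0 x 0 = x) ∧
      ∀ i : Fin m, (i : ℕ) < k → s'.nat SUCC 0 (e (S i)) 0 = e (S (finRotate m i)))
    ⟨fun x _ => by simpa using hsucc x x.2, by simp⟩ ?_
  · by_cases hx : x ∈ Set.range e
    · obtain ⟨i, rfl⟩ := hx
      have := h.2 (S.symm i) (by have := (S.symm i).2; lia)
      rw [apply_symm_apply] at this
      rw [this, Perm.viaEmbedding_apply]
      rfl
    · rw [Perm.viaEmbedding_apply_of_notMem _ _ _ hx, h.1 x hx]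
  · rintro k hk s' hs' hc ⟨h₁, h₂⟩
    have hrun := run_linkVertex (e := e) (S := S) (s := s') (k := k)
      (by rw [hs'.nat _ (by decide), hm]) (by rw [hs'.nat _ (by decide)]; exact hrep)
      (by rw [hs'.nat _ (by decide)]; exact hS) hc
    rw [Store.setNat_nat_of_ne _ _ _ _ _ (by decide)]
    refine ⟨fun x hx => ?_, fun i hi => ?_⟩
    · rw [hrun, h₁ x hx]
      split_ifs with h h'
      · exact absurd ⟨_, (Fin.ext h').symm⟩ hx
      all_goals rfl
    · rw [hrun]
      by_cases h : k < m
      · rw [dif_pos h]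
        by_cases hik : i = ⟨k, h⟩
        · rw [hik, if_pos rfl]
        · have hne : (e (S i) : ℕ) ≠ e (S ⟨k, h⟩) := fun h' =>
            hik (S.injective (e.injective (Fin.ext h')))
          rw [if_neg hne, h₂ i]
          have := Fin.val_ne_of_ne hik
          simp only at this
          lia
      · rw [dif_neg h, h₂ i (by lia)]

/-- The merger follows the permutation that takes the cycles of all rounds and the given tour of the
remaining vertices together. -/
theorem run_merger {s : Store} (hn : s.nat 0 0 0 0 = n) (hm : s.nat 2 0 0 0 = m)
    (hrep : ∀ i : Fin m, s.nat REP 0 i 0 = e i) (hS : ∀ i : Fin m, s.nat 3 0 i 0 = S i)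
    {p : Perm (Fin n)} (hp : ∀ x : Fin n, s.nat PATH 0 x 0 = p x)
    (hcyc : CyclicOn ((S * finRotate m * S⁻¹ : Perm (Fin m)).viaEmbedding e * p) univ) :
    ∃ π : Perm (Fin n), (∀ i : Fin n, (merger.run s).nat 4 i 0 0 = π i) ∧
      ∀ i, π (finRotate n i) =
        ((S * finRotate m * S⁻¹ : Perm (Fin m)).viaEmbedding e * p) (π i) := by
  obtain rfl | hpos := Nat.eq_zero_or_pos n
  · exact ⟨1, fun i => i.elim0, fun i => i.elim0⟩
  obtain ⟨π, hπ, hnext⟩ := hcyc.exists_order ⟨0, hpos⟩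
  refine ⟨π, fun i => ?_, hnext⟩
  have hfill := (run_fillNat (n := n) (c := CA) (v := SUCC) (a := 0) (i := .const 0)
      (e := .sc CA) hn (by decide) (fun k => k) (by simp +contextual [NExp.eval])).1
  have hfr : ∀ v ∉ [CA, SUCC], ((fillNat CA SUCC (.const 0) (.sc CA)).run s).nat v = s.nat v :=
    fun v hv => run_nat_of_notMem _ _ hv
  rw [merger, run_seq, run_seq, run_seq]
  revert hfill hfr
  generalize (fillNat CA SUCC (.const 0) (.sc CA)).run s = s₁
  intro hfill hfr
  have hlink := run_linkTour (e := e) (S := S) (s := s₁) (by rw [hfr _ (by decide), hn])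
    (by rw [hfr _ (by decide), hm]) (by rw [hfr _ (by decide)]; exact hrep)
    (by rw [hfr _ (by decide)]; exact hS) hfill
  have hfr₂ : ∀ v ∉ [CA, SUCC], ((forLt CA linkVertex).run s₁).nat v = s.nat v := fun v hv => by
    rw [run_nat_of_notMem _ _ (fun h => hv ?_), hfr v hv]
    simpa [natWrites, linkVertex] using h
  revert hlink hfr₂
  generalize (forLt CA linkVertex).run s₁ = s₂
  intro hlink hfr₂
  set g := (S * finRotate m * S⁻¹ : Perm (Fin m)).viaEmbedding e * p with hg
  have hloop := run_forLt (n := n) (c := CA) (p := visitVertex)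
    (s := (assign CUR (.const 0)).run s₂)
    (by rw [run_nat_of_notMem _ _ (by decide), hfr₂ _ (by decide), hn])
    (fun k s' => (∀ i < k, s'.nat 4 i 0 0 = ((g ^ i) ⟨0, hpos⟩ : Fin n)) ∧
      s'.nat CUR 0 0 0 = ((g ^ k) ⟨0, hpos⟩ : Fin n)) (by simp [run, NExp.eval]) ?_
  · rw [hloop.1 i i.2, hπ]
  · rintro k hk s' hs' hc ⟨h₁, h₂⟩
    have hpath : s'.nat PATH = s.nat PATH := by
      rw [hs'.nat _ (by decide), run_nat_of_notMem _ _ (by decide), hfr₂ _ (by decide)]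
    have hsucc : s'.nat SUCC = s₂.nat SUCC := by
      rw [hs'.nat _ (by decide), run_nat_of_notMem _ _ (by decide)]
    refine ⟨fun i hi => ?_, ?_⟩
    · by_cases hik : i = k
      · simp [visitVertex, run, NExp.eval, hc, h₂, hik]
      · simp [visitVertex, run, NExp.eval, hc, hik, h₁ i (by lia)]
    · simp [visitVertex, run, NExp.eval, h₂, hpath, hp, hsucc, hlink, pow_succ', hg]

end Merger

theorem wellFormed_rounds (k : ℕ) : (rounds k).WellFormed = true := by
  induction k with
  | zero => decide
  | succ k ih =>
    rw [rounds, WellFormed, ih]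
    decide

theorem wellFormed_reducer (k : ℕ) : (reducer k).WellFormed = true := by
  rw [reducer, WellFormed, wellFormed_rounds]
  decide

/-- The reducer produces a single instance, induced by a set of vertices on which every tour can be
extended to all vertices at the cost of `k` optimal tours. -/
theorem run_reducer (I : SemiMetricTSP) (k : ℕ) :
    ∃ (m : ℕ) (e : Fin m ↪ Fin I.n) (p : Perm (Fin I.n)),
      ((reducer k).run I.inputStore).nat 0 0 0 0 = I.n ∧
      ((reducer k).run I.inputStore).nat 1 0 0 0 = 1 ∧
      ((reducer k).run I.inputStore).nat 2 0 0 0 = m ∧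
      (∀ i : Fin m, ((reducer k).run I.inputStore).nat REP 0 i 0 = e i) ∧
      (∀ x y : Fin m, ((reducer k).run I.inputStore).real OUTPUT 0 x y = I.w (e x) (e y)) ∧
      (∀ x : Fin I.n, ((reducer k).run I.inputStore).nat PATH 0 x 0 = p x) ∧
      2 ^ k * m ≤ I.n + 2 ^ k ∧
      (∀ τ, CyclicOn τ (univ.map e) → CyclicOn (τ * p) univ) ∧
      ∀ τ, CyclicOn τ (univ.map e) →
        permCost I.w univ (τ * p) ≤ permCost I.w (univ.map e) τ + k * I.opt := by
  obtain ⟨A, p, h⟩ := run_rounds I k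
  rw [reducer, run_seq, run_seq]
  revert h
  generalize (rounds k).run I.inputStore = s
  intro h
  obtain ⟨m, e, rfl, hcount, hrep⟩ := run_listVertices h.toHoldsVertices
  have hcard := h.card_le
  rw [card_map, card_univ, Fintype.card_fin] at hcard
  have hA : HoldsVertices I.w (univ.map e) (listVertices.run s) :=
    h.toHoldsVertices.congr (run_nat_of_notMem _ _ (by decide)) (run_real_of_notMem _ _ (by decide))
      (run_nat_of_notMem _ _ (by decide))
  have hpath : ∀ x : Fin I.n, (listVertices.run s).nat PATH 0 x 0 = p x := by
    rw [run_nat_of_notMem _ _ (by decide)]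
    exact h.path
  have hout := run_writeInstance hA hrep
  refine ⟨m, e, p, ?_, ?_, ?_, fun i => ?_, hout, fun x => ?_, hcard, h.cyclicOn, h.permCost_le⟩
  · rw [run_nat_of_notMem _ _ (by decide), hA.size]
  · rw [writeInstance, run_seq, run_seq, run_nat_of_notMem _ _ (by decide)]
    simp [run, NExp.eval]
  · rw [writeInstance, run_seq, run_seq, run_nat_of_notMem _ _ (by decide)]
    simp [run, NExp.eval, hcount]
  · rw [run_nat_of_notMem _ _ (by decide), hrep]
  · rw [run_nat_of_notMem _ _ (by decide), hpath]

end SProg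

open SProg in
theorem SemiMetricTSP.hasPolyTimeReduction_two_pow (k : ℕ) :
    HasPolyTimeReduction (2 ^ k) fun α => α + k := by
  -- the summand `1` of the time bound covers the number of instances, and the constant `1` in the
  -- size of the instance covers the case that a single vertex remains before the last round
  refine ⟨(reducer k).compile, merger.compile, (reducer k).time + merger.time + 1, 1, fun I => ?_⟩
  obtain ⟨t, ht, hexec⟩ := exec_compile _ (wellFormed_reducer k) I.inputStore
  obtain ⟨m, e, p, hn, h₁, hm, hrep, hout, hpath, hcard, hcyc, hcost⟩ := run_reducer I k
  have hsize : I.inputStore.nat 0 0 0 0 = I.n := by simp [inputStore]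
  rw [hsize] at ht
  refine ⟨t, _, 1, fun _ => I.induced e, hexec, ⟨h₁, fun j => ?_⟩, by simp, fun _ => ?_, fun S => ?_⟩
  · obtain rfl := Subsingleton.elim j 0
    exact ⟨hm, hout⟩
  · have h2 : (0 : ℝ) < 2 ^ k := by positivity
    have hcard' : (2 : ℝ) ^ k * m ≤ I.n + 2 ^ k := by exact_mod_cast hcard
    change (m : ℝ) ≤ _
    rw [div_add_one h2.ne', le_div_iff₀ h2]
    linarith
  · set s := withSolutions ((reducer k).run I.inputStore) (fun _ => I.induced e) S with hs
    have hfr : ∀ v, v ≠ 3 → s.nat v = ((reducer k).run I.inputStore).nat v := fun v hv => by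
      simp [hs, withSolutions, hv]
    have hS : ∀ i : Fin m, s.nat 3 0 i 0 = (S 0 : Perm (Fin m)) i := fun i => by
      simp [hs, withSolutions, induced]
    have hτ := (cyclicOn_next (S 0)).viaEmbedding e
    obtain ⟨t', ht', hexec'⟩ := exec_compile merger (by decide) s
    rw [hfr 0 (by decide), hn] at ht'
    obtain ⟨π, hπ, hnext⟩ := run_merger (e := e) (S := S 0) (s := s) (p := p)
      (by rw [hfr 0 (by decide), hn]) (by rw [hfr 2 (by decide), hm])
      (by rw [hfr _ (by decide)]; exact hrep) hS (by rw [hfr _ (by decide)]; exact hpath)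
      (hcyc _ hτ)
    refine ⟨t', _, π, hexec', ?_, hπ, fun α hα hSα => ?_⟩
    · simp only [Polynomial.eval_add, Polynomial.eval_one]
      lia
    · have hw : permCost I.w (Finset.univ.map e) ((next (S 0)).viaEmbedding e) =
          (I.induced e).weight (S 0) :=
        (permCost_viaEmbedding I.w (next (S 0)) e).trans
          (weight_eq_permCost (S 0) fun i => (next_apply (S 0) i).symm).symm
      have hc := hcost _ hτ
      have hα' := hSα 0
      have hopt := mul_le_mul_of_nonneg_left (I.opt_induced_le e) (zero_le_one.trans hα)
      rw [hw] at hc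
      rw [weight_eq_permCost π hnext, add_mul]
      exact hc.trans (by linarith)

theorem mainTheorem10 :
    SemiMetricTSP.HasPolyTimeReductionScheme {r : ℝ | ∃ k : ℕ, r = 2 ^ k}
      (fun r α => α + Real.logb 2 r) := by
  refine ⟨fun ⟨b, hb⟩ => ?_, ?_⟩
  · obtain ⟨k, hk⟩ := pow_unbounded_of_one_lt b (one_lt_two : (1 : ℝ) < 2)
    exact (hb ⟨k, rfl⟩).not_gt hk
  · rintro _ ⟨k, rfl⟩
    have hlog : Real.logb 2 ((2 : ℝ) ^ k) = k := by
      rw [Real.logb_pow, Real.logb_self_eq_one one_lt_two, mul_one]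
    simp only [hlog]
    exact SemiMetricTSP.hasPolyTimeReduction_two_pow k
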